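/- Identify $\mathbb{C}^n=\mathbb{R}^{2n}$ with its standard Euclidean and symplectic structure and put $\lambda_0=\sum_k y_k\,dx_k$. Let $\mathcal{L}(n)$ be the Grassmannian of Lagrangian subspaces of $\mathbb{C}^n$ and $\Lambda\mathcal{L}(n)$ its free loop space (loops parametrized by $[0,1]$, compact-open topology). Let $\Omega_s\mathcal{L}(n)\subset\Lambda\mathcal{L}(n)$ be the subspace of loops of the form $$t\mapsto e^{i\pi t}V_+\oplus e^{-i\pi t}V_-\oplus V_0 ,$$ where $V_+,V_-,V_0\subset\mathbb{R}^n$ are pairwise orthogonal with $V_+\oplus V_-\oplus V_0=\mathbb{R}^n$. The loop determines these subspaces, so $V_+,V_-,V_0$ define canonical bundles over $\Omega_s\mathcal{L}(n)$; let $V_-^\perp=V_+\oplus V_0$ be the orthogonal complement of $V_-$ in $\mathbb{R}^n$. For a Lagrangian subspace $L\subset\mathbb{C}^n$ and points $z,z''\in\mathbb{C}^n$, write $z''-z=u_L+u_{L^\perp}$ with $u_L\in L$, $u_{L^\perp}\in L^\perp$. Let $\gamma^\llcorner(z,z'',L)$ be the path that runs along the segment from $z''$ to $z+u_L$ and then along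 the segment from $z+u_L$ to $z$. For $r\ge 1$ and a loop $\gamma$ in $\mathcal{L}(n)$, the finite reduction of the action integral with Hamiltonian $H=0$ is the function $$A_r^\gamma(\vec z)=\sum_{j\in\mathbb{Z}/r}\int_{\gamma^\llcorner(z_j,\,z_{j-1},\,\gamma(j/r))}\lambda_0,\qquad \vec z=(z_j)_{j\in\mathbb{Z}/r}\in\mathbb{C}^{nr}.$$ (For general $H$ with flow $\varphi_t$ the starting point $z_{j-1}$ is replaced by $\varphi_{1/r}(z_{j-1})$, and the terms $\int_{\gamma_j}(\lambda_0-H\,dt)$ over the flow curves $\gamma_j(t)=\varphi_t(z_j)$, $t\in[0,1/r]$, are added; they vanish for $H=0$.) Let $B_r^\gamma\colon\mathbb{C}^{nr}\to\mathbb{R}$ be the real quadratic form given by the Hessian of $A_r^\gamma$ at $0$. Its negative eigenspace is the real span of the eigenvectors, with respect to the standard real inner product, that have negative eigenvalue. There is an $r_0$ such that for all odd $r\ge r_0$ and all $n_1,n_2\ge 0$ the following holds. Let $X=\mathcal{L}(n_1)\times\Omega_s\mathcal{L}(n_2)$, let a point $(L,\gamma_1)\in X$ be regarded as the loop $\gamma(t)=L\oplus\gamma_1(t)$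 in $\mathcal{L}(n_1+n_2)$, and let $V_\pm$ also denote the pullbacks to $X$ of the canonical bundles over $\Omega_s\mathcal{L}(n_2)$. Then the negative eigenspaces of the forms $B_r^\gamma\colon\mathbb{C}^{(n_1+n_2)r}\to\mathbb{R}$, $\gamma\in X$, form a real vector bundle $\zeta$ over $X$ (a locally trivial subbundle of $X\times\mathbb{C}^{(n_1+n_2)r}$, whose rank may depend on the component), and there are isomorphisms of real vector bundles over $X$ $$\zeta\;\cong\;\mathbb{R}^{(n_1+n_2)(r-2)+n_1}\oplus V_+\oplus V_-^\perp \qquad\text{and}\qquad \zeta\oplus V_-\;\cong\;V_+\oplus\mathbb{R}^{(n_1+n_2)(r-1)} .$$ In particular, $\zeta$ equals $V_+-V_-$ plus a trivial bundle of dimension $(n_1+n_2)(r-1)$ as a virtual bundle. -/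

import Mathlib

open scoped unitInterval

noncomputable section

namespace MaslovReduction

/-! ### Lagrangian Grassmannians of the standard symplectic space `ℂ^ι` -/

section Lagrangians

variable {ι κ : Type*} [Fintype ι] [Fintype κ]

/-- Lagrangian subspaces of `ℂ^ι` (real subspaces equal to their own symplectic complement with
respect to the standard symplectic form, the imaginary part of the Hermitian inner product).
`Lag (Fin n)` is the Lagrangian Grassmannian of `ℂⁿ = ℝ²ⁿ`. -/
def Lag (ι : Type*) [Fintype ι] : Type _ :=
  {L : Submodule ℝ (EuclideanSpace ℂ ι) // ∀ v, v ∈ L ↔ ∀ u ∈ L, (inner ℂ u v).im = 0}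

/-- The usual topology of the Grassmannian: a subspace is identified with the orthogonal projection
onto it, in the normed space of real-linear operators. -/
instance : TopologicalSpace (Lag ι) :=
  TopologicalSpace.induced (fun L => L.1.starProjection) inferInstance

/-- The projection of `ℂ^(ι ⊕ κ) = ℂ^ι ⊕ ℂ^κ` to the first summand. -/
def fstC : EuclideanSpace ℂ (ι ⊕ κ) →ₗ[ℝ] EuclideanSpace ℂ ι where
  toFun v := WithLp.toLp 2 fun i => v (Sum.inl i)
  map_add' _ _ := rfl
  map_smul' _ _ := rfl

/-- The projection of `ℂ^(ι ⊕ κ) = ℂ^ι ⊕ ℂ^κ` to the second summand. -/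
def sndC : EuclideanSpace ℂ (ι ⊕ κ) →ₗ[ℝ] EuclideanSpace ℂ κ where
  toFun v := WithLp.toLp 2 fun i => v (Sum.inr i)
  map_add' _ _ := rfl
  map_smul' _ _ := rfl

@[simp] lemma fstC_apply (v : EuclideanSpace ℂ (ι ⊕ κ)) (i : ι) : fstC v i = v (Sum.inl i) := rfl

@[simp] lemma sndC_apply (v : EuclideanSpace ℂ (ι ⊕ κ)) (i : κ) : sndC v i = v (Sum.inr i) := rfl

lemma inner_sum_split (u v : EuclideanSpace ℂ (ι ⊕ κ)) :
    inner ℂ u v = inner ℂ (fstC u) (fstC v) + inner ℂ (sndC u) (sndC v) := by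
  simp [PiLp.inner_apply]

/-- The direct sum `L ⊕ M ⊂ ℂ^ι ⊕ ℂ^κ` of two Lagrangian subspaces. -/
def Lag.directSum (L : Lag ι) (M : Lag κ) : Lag (ι ⊕ κ) :=
  ⟨L.1.comap fstC ⊓ M.1.comap sndC, by
    intro v
    constructor
    · rintro ⟨h1, h2⟩ u ⟨k1, k2⟩
      rw [inner_sum_split, Complex.add_im, (L.2 _).1 h1 _ k1, (M.2 _).1 h2 _ k2, add_zero]
    · intro h
      refine ⟨(L.2 _).2 fun u hu => ?_, (M.2 _).2 fun u hu => ?_⟩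
      · have e1 : fstC (WithLp.toLp 2 (Sum.elim u (0 : κ → ℂ))) = u := by ext; simp
        have e2 : sndC (WithLp.toLp 2 (Sum.elim u (0 : κ → ℂ))) = 0 := by ext; simp
        have := h (WithLp.toLp 2 (Sum.elim u (0 : κ → ℂ)))
          ⟨by rw [SetLike.mem_coe, Submodule.mem_comap, e1]; exact hu,
            by rw [SetLike.mem_coe, Submodule.mem_comap, e2]; exact zero_mem _⟩
        rwa [inner_sum_split, e1, e2, inner_zero_left, add_zero] at this
      · have e1 : fstC (WithLp.toLp 2 (Sum.elim (0 : ι → ℂ) u)) = 0 := by ext; simp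
        have e2 : sndC (WithLp.toLp 2 (Sum.elim (0 : ι → ℂ) u)) = u := by ext; simp
        have := h (WithLp.toLp 2 (Sum.elim (0 : ι → ℂ) u))
          ⟨by rw [SetLike.mem_coe, Submodule.mem_comap, e1]; exact zero_mem _,
            by rw [SetLike.mem_coe, Submodule.mem_comap, e2]; exact hu⟩
        rwa [inner_sum_split, e1, e2, inner_zero_left, zero_add] at this⟩

end Lagrangians

/-! ### Loops of Lagrangians in standard form -/

section StandardLoops

variable {ι : Type*} [Fintype ι]

/-- The free loop space `Λ Y`, with the compact-open topology. -/
abbrev FreeLoop (Y : Type*) [TopologicalSpace Y] : Type _ := {γ : C(I, Y) // γ 0 = γ 1}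

/-- The real-linear map `ℝ^ι → ℂ^ι`, `v ↦ e^{iθ} v`. -/
def rot (θ : ℝ) : EuclideanSpace ℝ ι →ₗ[ℝ] EuclideanSpace ℂ ι where
  toFun v := WithLp.toLp 2 fun k => Complex.exp (θ * Complex.I) * (v k : ℂ)
  map_add' u v := by ext k; simp [mul_add]
  map_smul' c v := by ext k; simp [mul_left_comm]

/-- Pairwise orthogonal subspaces `V₊`, `V₋`, `V₀` of `ℝ^ι` with sum `ℝ^ι`. -/
@[ext] structure Triple (ι : Type*) [Fintype ι] where
  plus : Submodule ℝ (EuclideanSpace ℝ ι)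
  minus : Submodule ℝ (EuclideanSpace ℝ ι)
  zero : Submodule ℝ (EuclideanSpace ℝ ι)
  plus_minus : plus ⟂ minus
  plus_zero : plus ⟂ zero
  minus_zero : minus ⟂ zero
  sup_eq_top : plus ⊔ minus ⊔ zero = ⊤

/-- The subspace `e^{iπt} V₊ ⊕ e^{-iπt} V₋ ⊕ V₀` of `ℂ^ι`. -/
def Triple.curve (T : Triple ι) (t : ℝ) : Submodule ℝ (EuclideanSpace ℂ ι) :=
  T.plus.map (rot (Real.pi * t)) ⊔ T.minus.map (rot (-(Real.pi * t))) ⊔ T.zero.map (rot 0)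

lemma rot_apply (θ : ℝ) (v : EuclideanSpace ℝ ι) (k : ι) :
    rot θ v k = Complex.exp (θ * Complex.I) * (v k : ℂ) := rfl

lemma eq_zero_of_ortho {V W : Submodule ℝ (EuclideanSpace ℝ ι)} (h : V ⟂ W)
    {a : EuclideanSpace ℝ ι} (ha : a ∈ V) (hb : a ∈ W) : a = 0 :=
  (Submodule.disjoint_def.1 h.disjoint) a ha hb

lemma mem_curve_quarter {T : Triple ι} {w : EuclideanSpace ℂ ι} (h : w ∈ T.curve (1 / 4)) :
    ∃ a ∈ T.plus, ∃ b ∈ T.minus, ∃ c ∈ T.zero, ∀ k,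
      (w k).re = Real.sqrt 2 / 2 * (a k + b k) + c k ∧
      (w k).im = Real.sqrt 2 / 2 * (a k - b k) := by
  obtain ⟨x, hx, y, hy, rfl⟩ := Submodule.mem_sup.1 h
  obtain ⟨x1, hx1, x2, hx2, rfl⟩ := Submodule.mem_sup.1 hx
  obtain ⟨a, ha, rfl⟩ := hx1
  obtain ⟨b, hb, rfl⟩ := hx2
  obtain ⟨c, hc, rfl⟩ := hy
  refine ⟨a, ha, b, hb, c, hc, fun k => ?_⟩
  have e : Real.pi * (1 / 4) = Real.pi / 4 := by ring
  simp only [PiLp.add_apply, rot_apply, Complex.add_re, Complex.add_im, Complex.re_mul_ofReal,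
    Complex.im_mul_ofReal, Complex.exp_ofReal_mul_I_re, Complex.exp_ofReal_mul_I_im, e,
    Real.cos_neg, Real.sin_neg, Real.cos_zero, Real.sin_zero, Real.cos_pi_div_four,
    Real.sin_pi_div_four]
  constructor <;> ring

lemma Triple.le_of_curve {T T' : Triple ι} (h : T.curve (1 / 4) = T'.curve (1 / 4)) :
    T.plus ≤ T'.plus ∧ T.minus ≤ T'.minus ∧ T.zero ≤ T'.zero := by
  have e : Real.pi * (1 / 4) = Real.pi / 4 := by ring
  have h2 : (0 : ℝ) < Real.sqrt 2 / 2 := by positivity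
  refine ⟨fun v hv => ?_, fun v hv => ?_, fun v hv => ?_⟩
  · have hm : rot (Real.pi * (1 / 4)) v ∈ T'.curve (1 / 4) := by
      rw [← h]
      exact Submodule.mem_sup_left (Submodule.mem_sup_left (Submodule.mem_map_of_mem hv))
    obtain ⟨a, ha, b, hb, c, hc, H⟩ := mem_curve_quarter hm
    simp only [rot_apply, Complex.re_mul_ofReal, Complex.im_mul_ofReal,
      Complex.exp_ofReal_mul_I_re, Complex.exp_ofReal_mul_I_im, e, Real.cos_pi_div_four,
      Real.sin_pi_div_four] at H
    have hbc : Real.sqrt 2 • b = -c := by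
      ext k
      simp only [PiLp.smul_apply, PiLp.neg_apply, smul_eq_mul]
      linarith [(H k).1, (H k).2]
    have hb0 : b = 0 := by
      have := eq_zero_of_ortho T'.minus_zero (Submodule.smul_mem _ (Real.sqrt 2) hb)
        (hbc ▸ Submodule.neg_mem _ hc)
      simpa using this
    have : v = a := by
      ext k
      have := mul_left_cancel₀ h2.ne' (H k).2
      simpa [hb0] using this
    exact this ▸ ha
  · have hm : rot (-(Real.pi * (1 / 4))) v ∈ T'.curve (1 / 4) := by
      rw [← h]
      exact Submodule.mem_sup_left (Submodule.mem_sup_right (Submodule.mem_map_of_mem hv))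
    obtain ⟨a, ha, b, hb, c, hc, H⟩ := mem_curve_quarter hm
    simp only [rot_apply, Complex.re_mul_ofReal, Complex.im_mul_ofReal,
      Complex.exp_ofReal_mul_I_re, Complex.exp_ofReal_mul_I_im, e, Real.cos_neg, Real.sin_neg,
      Real.cos_pi_div_four, Real.sin_pi_div_four] at H
    have hac : Real.sqrt 2 • a = -c := by
      ext k
      simp only [PiLp.smul_apply, PiLp.neg_apply, smul_eq_mul]
      linarith [(H k).1, (H k).2]
    have ha0 : a = 0 := by
      have := eq_zero_of_ortho T'.plus_zero (Submodule.smul_mem _ (Real.sqrt 2) ha)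
        (hac ▸ Submodule.neg_mem _ hc)
      simpa using this
    have : v = b := by
      ext k
      have := (H k).2
      rw [ha0] at this
      simp only [PiLp.zero_apply, zero_sub] at this
      exact mul_left_cancel₀ h2.ne' (by linarith)
    exact this ▸ hb
  · have hm : rot 0 v ∈ T'.curve (1 / 4) := by
      rw [← h]
      exact Submodule.mem_sup_right (Submodule.mem_map_of_mem hv)
    obtain ⟨a, ha, b, hb, c, hc, H⟩ := mem_curve_quarter hm
    simp only [rot_apply, Complex.re_mul_ofReal, Complex.im_mul_ofReal,
      Complex.exp_ofReal_mul_I_re, Complex.exp_ofReal_mul_I_im, Real.cos_zero, Real.sin_zero,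
      one_mul, zero_mul] at H
    have hab : a = b := by
      ext k
      have h0 : Real.sqrt 2 / 2 * (a k - b k) = Real.sqrt 2 / 2 * 0 := by linarith [(H k).2]
      linarith [mul_left_cancel₀ h2.ne' h0]
    have ha0 : a = 0 := eq_zero_of_ortho T'.plus_minus ha (hab ▸ hb)
    have : v = c := by
      ext k
      have := (H k).1
      rw [← hab, ha0] at this
      simpa using this
    exact this ▸ hc

/-- The triple is determined by its curve. -/
lemma Triple.curve_injective {T T' : Triple ι} (h : ∀ t : I, T.curve t = T'.curve t) :
    T = T' := by
  have h4 : T.curve (1 / 4) = T'.curve (1 / 4) := h ⟨1 / 4, by norm_num, by norm_num⟩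
  obtain ⟨a, b, c⟩ := Triple.le_of_curve h4
  obtain ⟨a', b', c'⟩ := Triple.le_of_curve h4.symm
  exact Triple.ext (le_antisymm a a') (le_antisymm b b') (le_antisymm c c')

/-- The space `Ω_s` of loops in standard form, a subspace of the free loop space
of the Lagrangian Grassmannian. -/
def StdLoop (ι : Type*) [Fintype ι] : Type _ :=
  {γ : FreeLoop (Lag ι) // ∃ T : Triple ι, ∀ t : I, (γ.1 t).1 = T.curve t}

instance : TopologicalSpace (StdLoop ι) := instTopologicalSpaceSubtype

/-- The triple `(V₊, V₋, V₀)` defining a loop in standard form; it is unique by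
`Triple.curve_injective`. -/
def StdLoop.triple (γ : StdLoop ι) : Triple ι := γ.2.choose

/-- The fibre at `γ` of the canonical bundle `V₊`. -/
def Vplus (γ : StdLoop ι) : Submodule ℝ (EuclideanSpace ℝ ι) := γ.triple.plus

/-- The fibre at `γ` of the canonical bundle `V₋`. -/
def Vminus (γ : StdLoop ι) : Submodule ℝ (EuclideanSpace ℝ ι) := γ.triple.minus

end StandardLoops

/-! ### The finite reduction of the action on `(ℂ^ι)^r` -/

section FiniteReduction

variable {ι : Type*} [Fintype ι]

/-- The standard one-form `λ₀ = ∑ yₖ dxₖ` on `ℂ^ι`. -/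
def liouville (z : EuclideanSpace ℂ ι) : EuclideanSpace ℂ ι →L[ℝ] ℝ :=
  ∑ k, (z k).im • Complex.reCLM.comp ((EuclideanSpace.proj (𝕜 := ℂ) k).restrictScalars ℝ)

/-- The `L`-curve from `z''` to `z`: with `z'' - z = u_L + u_{L^⊥}`, first the segment (geodesic)
from `z''` to `z' = z + u_L`, then the segment from `z'` to `z`. -/
def LCurve (z z'' : EuclideanSpace ℂ ι) (L : Lag ι) : Path z'' z :=
  (Path.segment z'' (z + L.1.starProjection (z'' - z))).trans
    (Path.segment (z + L.1.starProjection (z'' - z)) z)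

/-- The time `j/r`, for `j ∈ ℤ/r` represented in `{0, …, r - 1}`. -/
def gridTime (r : ℕ) [NeZero r] (j : ZMod r) : I :=
  ⟨(j.val : ℝ) / r, by positivity,
    div_le_one_of_le₀ (by exact_mod_cast (ZMod.val_lt j).le) (by positivity)⟩

/-- The space `(ℂ^ι)^r` of `r`-tuples indexed by `ℤ/r`, with its Euclidean structure. -/
abbrev Config (r : ℕ) (ι : Type*) [Fintype ι] : Type _ :=
  PiLp 2 fun _ : ZMod r => EuclideanSpace ℂ ι

/-- The finite reduction `∑ⱼ (∫_{γⱼ} (λ₀ - H dt) + ∫_{γ^⌞ⱼ} λ₀)` of the action integral on flat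
`ℂ^ι`, for a Hamiltonian `H` with flow `φ` and the section given by the loop of Lagrangians `S`.
Here `γⱼ(t) = φ_t(zⱼ)` for `t ∈ [0, 1/r]`, and `γ^⌞ⱼ` is the `S(j/r)`-curve
from `zⱼ⁻ = φ_{1/r}(z_{j-1})` to `zⱼ`. -/
def finiteReduction (r : ℕ) [NeZero r] (H : EuclideanSpace ℂ ι → ℝ)
    (φ : ℝ → EuclideanSpace ℂ ι → EuclideanSpace ℂ ι) (S : I → Lag ι) (z : Config r ι) : ℝ :=
  ∑ j : ZMod r,
    ((∫ t in (0 : ℝ)..(1 / r),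
        (liouville (φ t (z j)) (deriv (fun s => φ s (z j)) t) - H (φ t (z j))))
      + curveIntegral liouville (LCurve (z j) (φ (1 / r) (z (j - 1))) (S (gridTime r j))))

/-- The Hessian at `0` of the finite reduction for `H = 0` (whose flow is the identity), as a
bilinear form; the quadratic form `B_r^S` is `z ↦ reductionHessian r S z z`. -/
def reductionHessian (r : ℕ) [NeZero r] (S : I → Lag ι) : Config r ι →L[ℝ] Config r ι →L[ℝ] ℝ :=
  fderiv ℝ (fderiv ℝ (finiteReduction r (fun _ => 0) (fun _ z => z) S)) 0

end FiniteReduction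

/-- The negative eigenspace of a bilinear form on a Euclidean space: the span of all its
eigenvectors with negative eigenvalue. -/
def negEigenspace {E : Type*} [NormedAddCommGroup E] [InnerProductSpace ℝ E]
    (B : E →L[ℝ] E →L[ℝ] ℝ) : Submodule ℝ E :=
  Submodule.span ℝ {u | ∃ μ : ℝ, μ < 0 ∧ ∀ v, B u v = μ * inner ℝ u v}

/-! ### Families of subspaces as bundles -/

section Bundles

variable {X E E' : Type*} [TopologicalSpace X]
  [AddCommGroup E] [Module ℝ E] [TopologicalSpace E]
  [AddCommGroup E'] [Module ℝ E'] [TopologicalSpace E']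

/-- The total space `{(x, v) | v ∈ W x} ⊂ X × E` of a family of subspaces, with the subspace
topology. -/
abbrev Total (W : X → Submodule ℝ E) : Type _ := {p : X × E // p.2 ∈ W p.1}

/-- An isomorphism of families of subspaces: a fibrewise linear homeomorphism over `X` between
the total spaces. -/
structure BundleIso (W : X → Submodule ℝ E) (W' : X → Submodule ℝ E') where
  equiv : ∀ x, W x ≃ₗ[ℝ] W' x
  continuous_equiv : Continuous fun p : Total W => (equiv p.1.1 ⟨p.1.2, p.2⟩ : E')
  continuous_symm : Continuous fun p : Total W' => ((equiv p.1.1).symm ⟨p.1.2, p.2⟩ : E)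

/-- The constant family with fibre `ℝᴺ`. -/
def trivialBundle (X : Type*) (N : ℕ) : X → Submodule ℝ (EuclideanSpace ℝ (Fin N)) := fun _ => ⊤

/-- A family of subspaces is a vector bundle if it is locally trivial (the rank may depend on the
component of the base). -/
def IsVectorBundle (W : X → Submodule ℝ E) : Prop :=
  ∀ x : X, ∃ U : Set X, IsOpen U ∧ x ∈ U ∧ ∃ N : ℕ,
    Nonempty (BundleIso (fun y : U => W y.1) (trivialBundle U N))

end Bundles

/-! ### The negative eigenbundle over `X = 𝓛(n₁) × Ω_s 𝓛(n₂)` -/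

/-- The base space `X = 𝓛(n₁) × Ω_s 𝓛(n₂)`. -/
abbrev Base (n₁ n₂ : ℕ) : Type := Lag (Fin n₁) × StdLoop (Fin n₂)

/-- The loop of Lagrangian subspaces `t ↦ L ⊕ γ₁(t)` of `ℂ^{n₁} ⊕ ℂ^{n₂}` given by a
point `(L, γ₁)` of the base. -/
def Base.loop {n₁ n₂ : ℕ} (x : Base n₁ n₂) (t : I) : Lag (Fin n₁ ⊕ Fin n₂) :=
  x.1.directSum (x.2.1.1 t)

/-- The family over `X` of the negative eigenspaces of the forms `B_r^γ`. -/
def negEigenbundle (r : ℕ) [NeZero r] (n₁ n₂ : ℕ) :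
    Base n₁ n₂ → Submodule ℝ (Config r (Fin n₁ ⊕ Fin n₂)) :=
  fun x => negEigenspace (reductionHessian r x.loop)

end MaslovReduction

end

open MaslovReduction

/-!
The Hessian of the finite reduction with `H = 0` is represented by a symmetric difference operator
on `(ℂ^ι)^r` (`reductionHessian_apply`), in which the Lagrangian subspaces enter through the
antilinear reflections in them. This operator separates: if `e^{iθⱼ} v` lies in the `j`-th
Lagrangian subspace for all `j`, it acts on the configurations `ν ⊗ v = (νⱼ v)ⱼ`, `ν ∈ ℂ^r`, through
a scalar operator on `ℂ^r` depending only on the angles `θⱼ` (`reductionOperator_tens`).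
At a point `(L, γ₁)` of the base, `ℂ^{n₁} ⊕ ℂ^{n₂}` is the orthogonal sum of the complexifications of
`L`, `V₀`, `V₊` and `V₋`, whose vectors have the angles `0`, `0`, `πj/r` and `-πj/r`. Hence, exactly
and not only up to homotopy, the negative eigenspace is a sum of copies of `L`, `V₀`, `V₊` and `V₋`,
one for each vector of a fixed basis of negative scalar eigenvectors (`negEigenbundleIso`). As the
projections onto these spaces depend continuously on the point, no perturbation theory
of eigenspaces is needed.

The number of copies is the index of a scalar form, which is `r - 1 + s` for the angles `sπj/r`
(`exists_scalar_eigenbasis`). By Sylvester's law it suffices to exhibit definite subspaces of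
sufficient dimension, the constants being in the kernel. For `s = 0` these are the graphs of the
difference operator and of its negative. For `s = 1` the form is negative on the `r`-dimensional
space of sections of the lines `e^{πij/r} ℝ`, and completing the square reduces it on a complement
to `∑ cos(π/r) yⱼ² + y_{j-1} yⱼ`, which is positive on a space of codimension `2` by the discrete
Wirtinger inequality of Fan, Taussky and Todd (`sum_mul_succ_le`). Complex conjugation exchanges
`s = 1` and `s = -1` and reverses the sign of the form.

So the negative eigenbundle consists of `r - 1` copies of `L` and of `V₀`, `r` copies of `V₊` and
`r - 2` copies of `V₋`. Since `r` is odd, the copies of `L` combine in pairs to the trivial bundle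
`L ⊕ L ≅ L ⊕ iL = ℂ^{n₁}`, and `r - 2` copies of each of `V₀`, `V₊` and `V₋` combine to copies of
`ℝ^{n₂}`. The remaining summands `V₊ ⊕ V₊ ⊕ V₀` give the two isomorphisms of the theorem.
-/

noncomputable section

namespace MaslovReduction

/-! ### Symmetric operators with an explicit index -/

section Inertia

variable {E : Type*} [NormedAddCommGroup E] [InnerProductSpace ℝ E]

lemma inner_apply_self_eq_sum {α : Type*} [Fintype α] (b : OrthonormalBasis α ℝ E)
    {T : E →ₗ[ℝ] E} {μ : α → ℝ} (hb : ∀ i, T (b i) = μ i • b i) (x : E) :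
    inner ℝ (T x) x = ∑ i, μ i * inner ℝ (b i) x ^ 2 := by
  conv_lhs => rw [← b.sum_repr' x, map_sum]
  rw [sum_inner]
  refine Finset.sum_congr rfl fun i _ => ?_
  rw [map_smul, hb, real_inner_smul_left, real_inner_smul_left, b.sum_repr' x]
  ring

/-- A space whose vectors are determined by the coordinates satisfying `p` has dimension at most
the number of those coordinates. -/
lemma finrank_le_card_of_coords {α : Type*} [Fintype α] (b : OrthonormalBasis α ℝ E)
    {A : Type*} [AddCommGroup A] [Module ℝ A]
    (f : A →ₗ[ℝ] E) (p : α → Prop) [DecidablePred p]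
    (h : ∀ a, (∀ i, p i → inner ℝ (b i) (f a) = 0) → a = 0) :
    Module.finrank ℝ A ≤ Fintype.card {i // p i} := by
  let g : A →ₗ[ℝ] ({i // p i} → ℝ) :=
    LinearMap.pi fun i => (innerₛₗ ℝ (b i.1)).comp f
  have hg : Function.Injective g := by
    rw [← LinearMap.ker_eq_bot, LinearMap.ker_eq_bot']
    intro a ha
    exact h a fun i hi => congrFun ha ⟨i, hi⟩
  simpa using LinearMap.finrank_le_finrank_of_injective hg

/-- Sylvester's law of inertia, in the form of an orthonormal eigenbasis: if a symmetric operator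
is negative definite on a copy of `A`, positive definite on a copy of `A'` and zero on a copy of
`A''`, and if the dimensions add up to that of the whole space, then exactly `dim A` vectors of an
orthonormal eigenbasis have negative eigenvalue. -/
theorem exists_eigenbasis_of_inertia [FiniteDimensional ℝ E] {T : E →ₗ[ℝ] E} (hT : T.IsSymmetric)
    {A A' A'' : Type*} [AddCommGroup A] [Module ℝ A] [AddCommGroup A'] [Module ℝ A']
    [AddCommGroup A''] [Module ℝ A'']
    (f : A →ₗ[ℝ] E) (f' : A' →ₗ[ℝ] E) (f'' : A'' →ₗ[ℝ] E)
    (hf : ∀ a, a ≠ 0 → inner ℝ (T (f a)) (f a) < 0)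
    (hf' : ∀ a, a ≠ 0 → 0 < inner ℝ (T (f' a)) (f' a))
    (hf'' : ∀ a, T (f'' a) = 0) (hinj : ∀ a, f'' a = 0 → a = 0)
    (hdim : Module.finrank ℝ E ≤
      Module.finrank ℝ A + Module.finrank ℝ A' + Module.finrank ℝ A'')
    (K : Type*) [Fintype K] (hK : Fintype.card K = Module.finrank ℝ A) :
    ∃ (n : ℕ) (b : OrthonormalBasis (K ⊕ Fin n) ℝ E) (μ : K ⊕ Fin n → ℝ),
      (∀ i, T (b i) = μ i • b i) ∧ (∀ i, μ (Sum.inl i) < 0) ∧ ∀ i, 0 ≤ μ (Sum.inr i) := by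
  classical
  let b := hT.eigenvectorBasis (n := Module.finrank ℝ E) rfl
  let μ : Fin (Module.finrank ℝ E) → ℝ := hT.eigenvalues rfl
  have hb : ∀ i, T (b i) = μ i • b i := fun i => hT.apply_eigenvectorBasis rfl i
  have h1 : Module.finrank ℝ A ≤ Fintype.card {i // μ i < 0} := by
    refine finrank_le_card_of_coords b f _ fun a ha => ?_
    by_contra h0
    refine absurd (hf a h0) (not_lt.2 ?_)
    rw [inner_apply_self_eq_sum b hb]
    refine Finset.sum_nonneg fun i _ => ?_
    by_cases hi : μ i < 0
    · simp [ha i hi]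
    · exact mul_nonneg (not_lt.1 hi) (sq_nonneg _)
  have h2 : Module.finrank ℝ A' ≤ Fintype.card {i // 0 < μ i} := by
    refine finrank_le_card_of_coords b f' _ fun a ha => ?_
    by_contra h0
    refine absurd (hf' a h0) (not_lt.2 ?_)
    rw [inner_apply_self_eq_sum b hb]
    refine Finset.sum_nonpos fun i _ => ?_
    by_cases hi : 0 < μ i
    · simp [ha i hi]
    · exact mul_nonpos_of_nonpos_of_nonneg (not_lt.1 hi) (sq_nonneg _)
  have h3 : Module.finrank ℝ A'' ≤ Fintype.card {i // μ i = 0} := by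
    refine finrank_le_card_of_coords b f'' _ fun a ha => hinj a ?_
    refine b.toBasis.ext_elem fun i => ?_
    have e : μ i * inner ℝ (b i) (f'' a) = 0 := by
      rw [← real_inner_smul_left, ← hb, hT, hf'', inner_zero_right]
    rcases mul_eq_zero.1 e with h | h
    · simp [b.repr_apply_apply, ha i h]
    · simp [b.repr_apply_apply, h]
  have h4 : Fintype.card {i // μ i < 0} + Fintype.card {i // 0 < μ i} +
      Fintype.card {i // μ i = 0} = Module.finrank ℝ E := by
    have e : (Finset.univ : Finset (Fin (Module.finrank ℝ E))) =
        (Finset.univ.filter fun i => μ i < 0) ∪ (Finset.univ.filter fun i => 0 < μ i) ∪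
        (Finset.univ.filter fun i => μ i = 0) := by
      ext i
      simp only [Finset.mem_univ, Finset.mem_union, Finset.mem_filter, true_and, true_iff]
      rcases lt_trichotomy (μ i) 0 with h | h | h <;> simp [h]
    rw [Fintype.card_subtype, Fintype.card_subtype, Fintype.card_subtype,
      ← Finset.card_union_of_disjoint, ← Finset.card_union_of_disjoint, ← e, Finset.card_univ,
      Fintype.card_fin]
    · rw [Finset.disjoint_left]
      intro i hi
      simp only [Finset.mem_union, Finset.mem_filter, Finset.mem_univ, true_and] at hi ⊢
      rcases hi with h | h
      exacts [h.ne, h.ne']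
    · rw [Finset.disjoint_left]
      intro i hi
      simp only [Finset.mem_filter, Finset.mem_univ, true_and] at hi ⊢
      exact not_lt.2 hi.le
  have h5 : Fintype.card {i // μ i < 0} = Fintype.card K := by omega
  let e : Fin (Module.finrank ℝ E) ≃ K ⊕ Fin (Fintype.card {i // ¬ μ i < 0}) :=
    (Equiv.sumCompl fun i => μ i < 0).symm.trans
      ((Fintype.equivOfCardEq h5).sumCongr (Fintype.equivFin _))
  refine ⟨_, b.reindex e, μ ∘ e.symm, fun i => ?_, fun i => ?_, fun i => ?_⟩
  · rw [OrthonormalBasis.reindex_apply, hb]; rfl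
  · exact ((Fintype.equivOfCardEq h5).symm i).2
  · exact not_lt.1 ((Fintype.equivFin {i // ¬ μ i < 0}).symm i).2

end Inertia

/-! ### The operator of a discrete action form -/

section DiscreteAction

variable {G : Type*} [NormedAddCommGroup G] [InnerProductSpace ℝ G] {r : ℕ}

lemma sum_shift [NeZero r] {M : Type*} [AddCommMonoid M] (f : ZMod r → M) :
    ∑ j, f (j - 1) = ∑ j, f j :=
  (Equiv.subRight (1 : ZMod r)).sum_comp f

/-- The operator on `G^r` representing the quadratic form
`∑ⱼ ⟨z_{j-1}, J zⱼ⟩ + ½ ⟨wⱼ, J Rⱼ wⱼ⟩` with `wⱼ = z_{j-1} - zⱼ`, where `J` is a complex structure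
and the `Rⱼ` are conjugations. -/
def discreteAction (J : G →ₗ[ℝ] G) (R : ZMod r → G →ₗ[ℝ] G) :
    PiLp 2 (fun _ : ZMod r => G) →ₗ[ℝ] PiLp 2 (fun _ : ZMod r => G) where
  toFun z := WithLp.toLp 2 fun j => (1 / 2 : ℝ) •
    J (z (j + 1) - z (j - 1) + R (j + 1) (z j - z (j + 1)) - R j (z (j - 1) - z j))
  map_add' z z' := by
    ext j
    simp only [PiLp.add_apply, map_add, map_sub, ← smul_add]
    congr 1
    abel
  map_smul' c z := by
    ext j
    simp only [PiLp.smul_apply, ← smul_sub, map_smul, ← smul_add, RingHom.id_apply]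
    rw [smul_comm]

lemma discreteAction_apply (J : G →ₗ[ℝ] G) (R : ZMod r → G →ₗ[ℝ] G)
    (z : PiLp 2 (fun _ : ZMod r => G)) (j : ZMod r) :
    discreteAction J R z j = (1 / 2 : ℝ) •
      J (z (j + 1) - z (j - 1) + R (j + 1) (z j - z (j + 1)) - R j (z (j - 1) - z j)) := rfl

/-- Constant configurations are annihilated. -/
lemma discreteAction_const (J : G →ₗ[ℝ] G) (R : ZMod r → G →ₗ[ℝ] G) (c : G) :
    discreteAction J R (WithLp.toLp 2 fun _ => c) = 0 := by
  ext j
  simp [discreteAction_apply]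

variable [NeZero r]

lemma inner_discreteAction (J : G →ₗ[ℝ] G) (R : ZMod r → G →ₗ[ℝ] G)
    (hJ : ∀ u v, inner ℝ (J u) v = -inner ℝ u (J v))
    (z z' : PiLp 2 (fun _ : ZMod r => G)) :
    inner ℝ (discreteAction J R z) z' = (1 / 2) * ∑ j, (inner ℝ (z' (j - 1)) (J (z j))
      + inner ℝ (z (j - 1)) (J (z' j))
      + inner ℝ (J (R j (z (j - 1) - z j))) (z' (j - 1) - z' j)) := by
  have e1 : ∑ j, inner ℝ (J (z (j + 1))) (z' j) = ∑ j, inner ℝ (J (z j)) (z' (j - 1)) := by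
    rw [← sum_shift fun j => inner ℝ (J (z (j + 1))) (z' j)]
    simp
  have e2 : ∑ j, inner ℝ (J (R (j + 1) (z j - z (j + 1)))) (z' j) =
      ∑ j, inner ℝ (J (R j (z (j - 1) - z j))) (z' (j - 1)) := by
    rw [← sum_shift fun j => inner ℝ (J (R (j + 1) (z j - z (j + 1)))) (z' j)]
    simp
  rw [PiLp.inner_apply, Finset.mul_sum]
  simp only [discreteAction_apply, real_inner_smul_left]
  rw [← Finset.mul_sum, ← Finset.mul_sum]
  congr 1
  have e3 : ∀ j, inner ℝ (J (z (j + 1) - z (j - 1) + R (j + 1) (z j - z (j + 1))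
      - R j (z (j - 1) - z j))) (z' j) = inner ℝ (J (z (j + 1))) (z' j)
      - inner ℝ (J (z (j - 1))) (z' j) + inner ℝ (J (R (j + 1) (z j - z (j + 1)))) (z' j)
      - inner ℝ (J (R j (z (j - 1) - z j))) (z' j) := by
    intro j
    rw [map_sub, map_add, map_sub, inner_sub_left, inner_add_left, inner_sub_left]
  rw [Finset.sum_congr rfl fun j _ => e3 j, Finset.sum_sub_distrib, Finset.sum_add_distrib,
    Finset.sum_sub_distrib, e1, e2, ← Finset.sum_sub_distrib, ← Finset.sum_add_distrib,
    ← Finset.sum_sub_distrib]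
  refine Finset.sum_congr rfl fun j _ => ?_
  rw [hJ (z (j - 1)), inner_sub_right, real_inner_comm (z' (j - 1)) (J (z j))]
  ring

lemma inner_discreteAction_self (J : G →ₗ[ℝ] G) (R : ZMod r → G →ₗ[ℝ] G)
    (hJ : ∀ u v, inner ℝ (J u) v = -inner ℝ u (J v))
    (z : PiLp 2 (fun _ : ZMod r => G)) :
    inner ℝ (discreteAction J R z) z = ∑ j, (inner ℝ (z (j - 1)) (J (z j))
      + (1 / 2) * inner ℝ (z (j - 1) - z j) (J (R j (z (j - 1) - z j)))) := by
  rw [inner_discreteAction J R hJ, Finset.mul_sum]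
  refine Finset.sum_congr rfl fun j _ => ?_
  rw [real_inner_comm (z (j - 1) - z j)]
  ring

lemma discreteAction_isSymmetric (J : G →ₗ[ℝ] G) (R : ZMod r → G →ₗ[ℝ] G)
    (hJ : ∀ u v, inner ℝ (J u) v = -inner ℝ u (J v))
    (hR : ∀ j u v, inner ℝ (R j u) v = inner ℝ u (R j v))
    (hJR : ∀ j u, R j (J u) = -J (R j u)) :
    (discreteAction J R).IsSymmetric := by
  intro z z'
  rw [inner_discreteAction J R hJ, real_inner_comm (discreteAction J R z') z,
    inner_discreteAction J R hJ]
  congr 1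
  refine Finset.sum_congr rfl fun j _ => ?_
  have : inner ℝ (J (R j (z (j - 1) - z j))) (z' (j - 1) - z' j) =
      inner ℝ (J (R j (z' (j - 1) - z' j))) (z (j - 1) - z j) := by
    rw [hJ, hR, hJR, inner_neg_right, neg_neg, real_inner_comm]
  rw [this]
  ring

end DiscreteAction

/-! ### A discrete Wirtinger inequality -/

section Wirtinger

/-- The inequality of Fan, Taussky and Todd: for sequences vanishing at both ends, the form
`∑ aⱼ aⱼ₊₁` is at most `cos (π / N)` times the square norm. -/
lemma sum_mul_succ_le (N : ℕ) (hN : 1 ≤ N) (a : ℕ → ℝ) (h0 : a 0 = 0) (hN0 : a N = 0) :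
    ∑ j ∈ Finset.range N, a j * a (j + 1) ≤
      Real.cos (Real.pi / N) * ∑ j ∈ Finset.range N, a j ^ 2 := by
  obtain rfl | hN2 := hN.eq_or_lt
  · simp [h0]
  set c := Real.cos (Real.pi / N)
  let s : ℕ → ℝ := fun j => Real.sin (Real.pi / N * j)
  have hNpos : (0 : ℝ) < N := by positivity
  have hs : ∀ j, 1 ≤ j → j < N → 0 < s j := by
    intro j h1 h2
    have h1' : (0 : ℝ) < j := by exact_mod_cast h1
    have h2' : (j : ℝ) < N := by exact_mod_cast h2
    refine Real.sin_pos_of_pos_of_lt_pi (by positivity) ?_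
    rw [div_mul_eq_mul_div, div_lt_iff₀ hNpos]
    exact mul_lt_mul_of_pos_left h2' Real.pi_pos
  have hrec : ∀ j, s (j + 2) = 2 * c * s (j + 1) - s j := by
    intro j
    simp only [s, c]
    have e1 : Real.pi / N * ((j + 2 : ℕ) : ℝ) = Real.pi / N * ((j + 1 : ℕ) : ℝ) + Real.pi / N := by
      push_cast; ring
    have e2 : Real.pi / N * (j : ℝ) = Real.pi / N * ((j + 1 : ℕ) : ℝ) - Real.pi / N := by
      push_cast; ring
    rw [e1, e2, Real.sin_add, Real.sin_sub]
    ring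
  -- Completing squares successively (the Riccati form of the Jacobi condition).
  have key : ∀ M, M + 1 < N →
      s (M + 2) * a (M + 1) ^ 2 ≤ s (M + 1) *
        (2 * c * ∑ j ∈ Finset.range (M + 2), a j ^ 2
          - 2 * ∑ j ∈ Finset.range (M + 1), a j * a (j + 1)) := by
    intro M
    induction M with
    | zero =>
      intro _
      have : s 0 = 0 := by simp [s]
      rw [hrec 0, this]
      simp [Finset.sum_range_succ, h0]
      linarith
    | succ M ih =>
      intro hM
      have ih := ih (by omega)
      have p1 := hs (M + 1) (by omega) (by omega)
      have p2 := hs (M + 2) (by omega) hM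
      rw [Finset.sum_range_succ, Finset.sum_range_succ (fun j => a j * a (j + 1)), hrec (M + 1)]
      set Q := 2 * c * ∑ j ∈ Finset.range (M + 2), a j ^ 2
          - 2 * ∑ j ∈ Finset.range (M + 1), a j * a (j + 1) with hQ
      have e : s (M + 1 + 1) * (2 * c * (∑ j ∈ Finset.range (M + 2), a j ^ 2 + a (M + 2) ^ 2)
          - 2 * (∑ j ∈ Finset.range (M + 1), a j * a (j + 1) + a (M + 1) * a (M + 1 + 1)))
          = s (M + 2) * (Q + 2 * c * a (M + 2) ^ 2 - 2 * (a (M + 1) * a (M + 2))) := by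
        rw [hQ]; ring
      rw [e]
      have : 0 ≤ s (M + 1) * (s (M + 2) * (Q + 2 * c * a (M + 2) ^ 2
          - 2 * (a (M + 1) * a (M + 2))) - (2 * c * s (M + 2) - s (M + 1)) * a (M + 2) ^ 2) := by
        have q := mul_le_mul_of_nonneg_left ih p2.le
        nlinarith [sq_nonneg (s (M + 2) * a (M + 1) - s (M + 1) * a (M + 2))]
      have := nonneg_of_mul_nonneg_right this p1
      linarith
  obtain ⟨M, rfl⟩ : ∃ M, N = M + 2 := ⟨N - 2, by omega⟩
  have hk := key M (by omega)
  have p1 := hs (M + 1) (by omega) (by omega)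
  have hend : s (M + 2) = 0 := by
    simp only [s]
    rw [div_mul_cancel₀ _ hNpos.ne', Real.sin_pi]
  rw [hend, zero_mul] at hk
  have := nonneg_of_mul_nonneg_right hk p1
  rw [Finset.sum_range_succ (fun j => a j * a (j + 1)), hN0, mul_zero, add_zero]
  linarith

lemma sum_zmod_eq_sum_range {r : ℕ} [NeZero r] {M : Type*} [AddCommMonoid M] (f : ZMod r → M) :
    ∑ j, f j = ∑ j ∈ Finset.range r, f (j : ZMod r) := by
  symm
  refine Finset.sum_bij (fun j _ => (j : ZMod r)) (fun _ _ => Finset.mem_univ _) ?_ ?_ ?_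
  · intro i hi j hj h
    rw [Finset.mem_range] at hi hj
    have := congrArg ZMod.val h
    rwa [ZMod.val_cast_of_lt hi, ZMod.val_cast_of_lt hj] at this
  · intro j _
    exact ⟨j.val, Finset.mem_range.2 (ZMod.val_lt j), ZMod.natCast_zmod_val j⟩
  · simp

/-- On functions on `ℤ/r` vanishing at two adjacent points, the form `∑ C yⱼ² + y_{j-1} yⱼ` with
`C = cos (π / r)` is positive definite. -/
lemma sum_cos_mul_sq_add_pos {r : ℕ} [NeZero r] (hr : 3 ≤ r) (y : ZMod r → ℝ) (h0 : y 0 = 0)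
    (h1 : y 1 = 0) (hy : y ≠ 0) :
    0 < ∑ j, (Real.cos (Real.pi / r) * y j ^ 2 + y (j - 1) * y j) := by
  obtain ⟨N, rfl⟩ : ∃ N, r = N + 1 := ⟨r - 1, by omega⟩
  have hw := sum_mul_succ_le N (by omega) (fun j => |y ((j + 1 : ℕ) : ZMod (N + 1))|)
    (by simp [h1]) (by simp [h0])
  have e1 : ∑ j, |y j| * |y (j + 1)| =
      ∑ j ∈ Finset.range N, |y ((j + 1 : ℕ) : ZMod (N + 1))| *
        |y ((j + 1 + 1 : ℕ) : ZMod (N + 1))| := by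
    rw [sum_zmod_eq_sum_range, Finset.sum_range_succ']
    simp [h0]
  have e2 : ∑ j, |y j| ^ 2 =
      ∑ j ∈ Finset.range N, |y ((j + 1 : ℕ) : ZMod (N + 1))| ^ 2 := by
    rw [sum_zmod_eq_sum_range, Finset.sum_range_succ']
    simp [h0]
  rw [← e1, ← e2] at hw
  have hN : (0 : ℝ) < N := by exact_mod_cast (by omega : 0 < N)
  -- Two adjacent zeros shorten the path: the constant improves from `cos (π/r)` to
  -- `cos (π/(r-1))`.
  have hcos : Real.cos (Real.pi / N) < Real.cos (Real.pi / (N + 1 : ℕ)) := by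
    refine Real.cos_lt_cos_of_nonneg_of_le_pi (by positivity) ?_ ?_
    · exact div_le_self Real.pi_pos.le (by exact_mod_cast (by omega : 1 ≤ N))
    · refine div_lt_div_of_pos_left Real.pi_pos hN ?_
      push_cast; linarith
  have hpos : 0 < ∑ j, |y j| ^ 2 := by
    obtain ⟨i, hi⟩ := Function.ne_iff.1 hy
    exact Finset.sum_pos' (fun _ _ => sq_nonneg _) ⟨i, Finset.mem_univ _, by
      have : 0 < |y i| := abs_pos.2 hi
      positivity⟩
  have hsh : ∑ j, y (j - 1) * y j = ∑ j, y j * y (j + 1) := by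
    rw [← sum_shift fun j => y j * y (j + 1)]
    simp
  have hle : -∑ j, y j * y (j + 1) ≤ ∑ j, |y j| * |y (j + 1)| := by
    rw [← Finset.sum_neg_distrib]
    exact Finset.sum_le_sum fun j _ => by rw [← abs_mul]; exact neg_le_abs _
  rw [Finset.sum_add_distrib, ← Finset.mul_sum, hsh]
  simp only [sq_abs] at hw hpos
  nlinarith

end Wirtinger

/-! ### The scalar forms -/

section Scalar

/-- Multiplication by `i`, as a real-linear map. -/
def mulI (G : Type*) [AddCommGroup G] [Module ℝ G] [Module ℂ G] [SMulCommClass ℝ ℂ G] :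
    G →ₗ[ℝ] G where
  toFun v := Complex.I • v
  map_add' := smul_add _
  map_smul' c v := (smul_comm c Complex.I v).symm

lemma mulI_apply {G : Type*} [AddCommGroup G] [Module ℝ G] [Module ℂ G] [SMulCommClass ℝ ℂ G]
    (v : G) : mulI G v = Complex.I • v := rfl

/-- The map `c ↦ ρ c̄`, for `|ρ| = 1` the reflection of `ℂ` in a line. -/
def conjMul (ρ : ℂ) : ℂ →ₗ[ℝ] ℂ where
  toFun c := ρ * (starRingEnd ℂ) c
  map_add' := by intros; simp [mul_add]
  map_smul' := by intros; simp [mul_left_comm]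

lemma conjMul_apply (ρ c : ℂ) : conjMul ρ c = ρ * (starRingEnd ℂ) c := rfl

variable {r : ℕ}

/-- The operator on `ℂ^r` representing the discrete action form of the lines with reflections
`c ↦ ρⱼ c̄`. -/
def scalarAction (ρ : ZMod r → ℂ) :
    EuclideanSpace ℂ (ZMod r) →ₗ[ℝ] EuclideanSpace ℂ (ZMod r) :=
  discreteAction (mulI ℂ) fun j => conjMul (ρ j)

lemma inner_mulI_complex (u v : ℂ) : inner ℝ (mulI ℂ u) v = -inner ℝ u (mulI ℂ v) := by
  simp [Complex.inner, mulI_apply]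
  ring

variable [NeZero r]

lemma scalarAction_isSymmetric (ρ : ZMod r → ℂ) : (scalarAction ρ).IsSymmetric := by
  refine discreteAction_isSymmetric _ _ inner_mulI_complex (fun j u v => ?_) fun j u => ?_
  · simp [Complex.inner, conjMul_apply]
    ring
  · simp [mulI_apply, conjMul_apply]
    ring

/-- The quadratic form of `scalarAction ρ` in the moving frame `η` with `ρⱼ = ηⱼ²`. -/
lemma inner_scalarAction_frame {ρ η : ZMod r → ℂ} {ε : ℂ} (hη : ∀ j, Complex.normSq (η j) = 1)
    (hρ : ∀ j, ρ j = η j ^ 2) (hε : ∀ j, η (j - 1) = η j * ε) (u : ZMod r → ℂ) :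
    inner ℝ (scalarAction ρ (WithLp.toLp 2 fun j => η j * u j))
      (WithLp.toLp 2 fun j => η j * u j) =
      ∑ j, ((ε * u (j - 1)).re * (ε * u (j - 1)).im + (u j).re * (u j).im
        - 2 * (ε * u (j - 1)).re * (u j).im) := by
  rw [scalarAction, inner_discreteAction_self _ _ inner_mulI_complex]
  refine Finset.sum_congr rfl fun j _ => ?_
  have h1 : η (j - 1) * u (j - 1) = η j * (ε * u (j - 1)) := by rw [hε, mul_assoc]
  simp only [h1, ← mul_sub, mulI_apply, conjMul_apply, hρ]
  have h2 := hη j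
  rw [Complex.normSq_apply] at h2
  generalize ε * u (j - 1) = p
  generalize u j = q
  generalize η j = e at h2 ⊢
  have h3 : e ^ 2 * (starRingEnd ℂ) (e * (p - q)) = e * (starRingEnd ℂ) (p - q) := by
    have : e * (starRingEnd ℂ) e = 1 := by
      rw [Complex.mul_conj, Complex.normSq_apply, h2, Complex.ofReal_one]
    rw [map_mul]
    linear_combination (e * (starRingEnd ℂ) (p - q)) * this
  rw [h3]
  have h4 : ∀ a b : ℂ, inner ℝ (e * a) (Complex.I • (e * b)) = a.im * b.re - a.re * b.im := by
    intro a b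
    simp only [Complex.inner, smul_eq_mul, Complex.mul_re, Complex.mul_im, Complex.I_re,
      Complex.I_im, Complex.conj_re, Complex.conj_im]
    linear_combination (a.im * b.re - a.re * b.im) * h2
  rw [h4, h4]
  simp
  ring

/-- Complex conjugation reverses the sign of the form and conjugates the lines. -/
lemma inner_scalarAction_conj (ρ : ZMod r → ℂ) (z : ZMod r → ℂ) :
    inner ℝ (scalarAction (fun j => (starRingEnd ℂ) (ρ j))
      (WithLp.toLp 2 fun j => (starRingEnd ℂ) (z j)))
      (WithLp.toLp 2 fun j => (starRingEnd ℂ) (z j)) =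
      -inner ℝ (scalarAction ρ (WithLp.toLp 2 z)) (WithLp.toLp 2 z) := by
  rw [scalarAction, scalarAction, inner_discreteAction_self _ _ inner_mulI_complex,
    inner_discreteAction_self _ _ inner_mulI_complex, ← Finset.sum_neg_distrib]
  refine Finset.sum_congr rfl fun j _ => ?_
  simp [mulI_apply, conjMul_apply, Complex.inner]
  ring

end Scalar

/-! ### The index of the scalar forms -/

section ScalarSpectrum

variable {r : ℕ} [NeZero r]

/-- The reflections `c ↦ e^{2πisj/r} c̄` of the lines `e^{πisj/r} ℝ`, for `s ∈ {0, 1, -1}`. -/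
def gridRho (r : ℕ) [NeZero r] (s : SignType) (j : ZMod r) : ℂ :=
  Complex.exp ((2 * ((s : ℝ) * (Real.pi * (gridTime r j : ℝ))) : ℝ) * Complex.I)

lemma gridRho_zero : gridRho r 0 = fun _ => 1 := by
  ext j
  simp [gridRho]

lemma gridRho_one (j : ZMod r) : gridRho r 1 j = ZMod.stdAddChar j := by
  have := ZMod.stdAddChar_coe (N := r) (j.val : ℤ)
  rw [Int.cast_natCast, ZMod.natCast_zmod_val] at this
  rw [this, gridRho]
  congr 1
  simp only [gridTime, SignType.coe_one]
  push_cast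
  ring

lemma gridRho_neg_one : gridRho r (-1) = fun j => (starRingEnd ℂ) (gridRho r 1 j) := by
  ext j
  rw [gridRho, gridRho, ← Complex.exp_conj]
  congr 1
  simp [map_ofNat]

/-- Extension by zero of a function defined on a subset of `ℤ/r`. -/
def extendZero (p : ZMod r → Prop) [DecidablePred p] : ({j // p j} → ℝ) →ₗ[ℝ] (ZMod r → ℝ) where
  toFun y j := if h : p j then y ⟨j, h⟩ else 0
  map_add' y y' := by
    ext j
    by_cases h : p j <;> simp [h]
  map_smul' c y := by
    ext j
    by_cases h : p j <;> simp [h]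

lemma extendZero_apply_of_not {p : ZMod r → Prop} [DecidablePred p] (y : {j // p j} → ℝ)
    {j : ZMod r} (h : ¬ p j) : extendZero p y j = 0 := dif_neg h

lemma extendZero_ne_zero {p : ZMod r → Prop} [DecidablePred p] {y : {j // p j} → ℝ} (hy : y ≠ 0) :
    extendZero p y ≠ 0 := by
  obtain ⟨⟨j, hj⟩, h⟩ := Function.ne_iff.1 hy
  refine Function.ne_iff.2 ⟨j, ?_⟩
  rwa [extendZero, LinearMap.coe_mk, AddHom.coe_mk, dif_pos hj]

/-- The vectors `ηⱼ (xⱼ + i yⱼ)`, with `x` and `y` depending linearly on a parameter. -/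
def frameMap {A : Type*} [AddCommGroup A] [Module ℝ A] (η : ZMod r → ℂ)
    (x y : A →ₗ[ℝ] (ZMod r → ℝ)) : A →ₗ[ℝ] EuclideanSpace ℂ (ZMod r) where
  toFun a := WithLp.toLp 2 fun j => η j * ⟨x a j, y a j⟩
  map_add' a b := by
    ext j
    apply Complex.ext <;> simp <;> ring
  map_smul' c a := by
    ext j
    apply Complex.ext <;> simp <;> ring

/-- The difference operator `y ↦ (yⱼ - y_{j-1})ⱼ`. -/
def backwardDiff : (ZMod r → ℝ) →ₗ[ℝ] (ZMod r → ℝ) where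
  toFun y j := y j - y (j - 1)
  map_add' y y' := by ext j; simp; ring
  map_smul' c y := by ext j; simp; ring

lemma backwardDiff_apply (y : ZMod r → ℝ) (j : ZMod r) :
    backwardDiff y j = y j - y (j - 1) := rfl

lemma eq_zero_of_backwardDiff {y : ZMod r → ℝ} (h : backwardDiff y = 0) (h0 : y 0 = 0) :
    y = 0 := by
  have : ∀ n : ℕ, y (n : ZMod r) = 0 := by
    intro n
    induction n with
    | zero => simpa using h0
    | succ n ih =>
      have e := congrFun h ((n + 1 : ℕ) : ZMod r)
      rw [backwardDiff_apply] at e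
      simp only [Nat.cast_add, Nat.cast_one, add_sub_cancel_right, ih, sub_zero] at e
      simpa using e
  ext j
  simpa using this j.val

/-- For constant lines the form is the pairing of the imaginary part with the difference of the
real part. -/
lemma inner_scalarAction_zero (t : ℝ) (x : ZMod r → ℝ) :
    inner ℝ (scalarAction (gridRho r 0) (frameMap (fun _ => 1) LinearMap.id (t • backwardDiff) x))
      (frameMap (fun _ => 1) LinearMap.id (t • backwardDiff) x) =
      2 * t * ∑ j, backwardDiff x j ^ 2 := by
  have h := inner_scalarAction_frame (ρ := gridRho r 0) (η := fun _ => 1) (ε := 1)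
    (by simp) (by simp [gridRho_zero]) (by simp) (fun j => ⟨x j, t * backwardDiff x j⟩)
  refine h.trans ?_
  simp only [one_mul]
  rw [Finset.sum_sub_distrib, Finset.sum_add_distrib,
    sum_shift fun j => x j * (t * backwardDiff x j), ← Finset.sum_add_distrib,
    ← Finset.sum_sub_distrib, Finset.mul_sum]
  refine Finset.sum_congr rfl fun j _ => ?_
  rw [backwardDiff_apply]
  ring

/-- For constant lines there are definite subspaces of dimension `r - 1` of either sign, the
graphs of the difference operator and of its negative. -/
lemma exists_definite_zero :
    ∃ f f' : ({j : ZMod r // j ≠ 0} → ℝ) →ₗ[ℝ] EuclideanSpace ℂ (ZMod r),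
      (∀ a, a ≠ 0 → inner ℝ (scalarAction (gridRho r 0) (f a)) (f a) < 0) ∧
      (∀ a, a ≠ 0 → 0 < inner ℝ (scalarAction (gridRho r 0) (f' a)) (f' a)) := by
  have hpos : ∀ a : {j : ZMod r // j ≠ 0} → ℝ, a ≠ 0 →
      0 < ∑ j, backwardDiff (extendZero _ a) j ^ 2 := by
    intro a ha
    have h : backwardDiff (extendZero _ a) ≠ 0 := fun h => extendZero_ne_zero ha
      (eq_zero_of_backwardDiff h (extendZero_apply_of_not a (by simp)))
    obtain ⟨j, hj⟩ := Function.ne_iff.1 h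
    exact Finset.sum_pos' (fun _ _ => sq_nonneg _) ⟨j, Finset.mem_univ _, by
      have : backwardDiff (extendZero _ a) j ≠ 0 := hj
      positivity⟩
  refine ⟨(frameMap (fun _ => 1) LinearMap.id ((-1 : ℝ) • backwardDiff)).comp (extendZero _),
    (frameMap (fun _ => 1) LinearMap.id ((1 : ℝ) • backwardDiff)).comp (extendZero _),
    fun a ha => ?_, fun a ha => ?_⟩
  · rw [LinearMap.comp_apply, inner_scalarAction_zero]
    linarith [hpos a ha]
  · rw [LinearMap.comp_apply, inner_scalarAction_zero]
    linarith [hpos a ha]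

/-- The square root of `gridRho r 1` which is periodic in `j`; it exists as `r` is odd, and its
value at `1` is `-e^{πi/r}`. -/
lemma exists_frame (hodd : Odd r) : ∃ η : ZMod r → ℂ, (∀ j, Complex.normSq (η j) = 1) ∧
    (∀ j, gridRho r 1 j = η j ^ 2) ∧
    ∀ j, η (j - 1) = η j * ⟨-Real.cos (Real.pi / r), Real.sin (Real.pi / r)⟩ := by
  obtain ⟨m, hm⟩ := hodd
  have h2 : (2 * (m + 1) : ZMod r) = 1 := by
    have : ((2 * m + 1 : ℕ) : ZMod r) = 0 := by rw [← hm, ZMod.natCast_self]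
    push_cast at this
    linear_combination this
  have hn : ∀ j : ZMod r, ‖(ZMod.stdAddChar j : ℂ)‖ = 1 := fun j => by
    rw [ZMod.stdAddChar_apply, Circle.norm_coe]
  refine ⟨fun j => ZMod.stdAddChar (((m : ZMod r) + 1) * j), fun j => ?_, fun j => ?_, fun j => ?_⟩
  · rw [Complex.normSq_eq_norm_sq, hn, one_pow]
  · rw [gridRho_one, ← AddChar.map_nsmul_eq_pow]
    congr 1
    rw [nsmul_eq_mul]
    push_cast
    linear_combination (-j) * h2
  · have e : ((m : ZMod r) + 1) * (j - 1) = (m + 1) * j + ((-(m + 1) : ℤ) : ZMod r) := by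
      push_cast
      ring
    have hr0 : (r : ℂ) ≠ 0 := NeZero.ne _
    have hmr : ((m : ℂ) + 1) = (r + 1) / 2 := by
      rw [hm]
      push_cast
      ring
    simp only
    rw [e, AddChar.map_add_eq_mul, ZMod.stdAddChar_coe]
    congr 1
    have e2 : 2 * (Real.pi : ℂ) * Complex.I * ((-(m + 1) : ℤ) : ℂ) / r =
        ((-Real.pi : ℝ) : ℂ) * Complex.I + ((-(Real.pi / r) : ℝ) : ℂ) * Complex.I := by
      push_cast
      rw [hmr]
      field_simp
      ring
    rw [e2, Complex.exp_add, Complex.exp_mul_I, Complex.exp_mul_I, ← Complex.ofReal_cos,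
      ← Complex.ofReal_sin, ← Complex.ofReal_cos, ← Complex.ofReal_sin]
    simp only [Real.cos_neg, Real.sin_neg, Real.cos_pi, Real.sin_pi]
    generalize Real.cos (Real.pi / r) = c, Real.sin (Real.pi / r) = d
    apply Complex.ext <;> simp

/-- For the lines `e^{πij/r} ℝ` there are a negative definite subspace of dimension `r`, consisting
of the sections of the lines, and a positive definite subspace of dimension `r - 2`. -/
lemma exists_definite_one (hodd : Odd r) (hr : 3 ≤ r) :
    ∃ (f : (ZMod r → ℝ) →ₗ[ℝ] EuclideanSpace ℂ (ZMod r))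
      (f' : ({j : ZMod r // j ≠ 0 ∧ j ≠ 1} → ℝ) →ₗ[ℝ] EuclideanSpace ℂ (ZMod r)),
      (∀ a, a ≠ 0 → inner ℝ (scalarAction (gridRho r 1) (f a)) (f a) < 0) ∧
      (∀ a, a ≠ 0 → 0 < inner ℝ (scalarAction (gridRho r 1) (f' a)) (f' a)) := by
  obtain ⟨η, h1, h2, h3⟩ := exists_frame (r := r) hodd
  have hr' : (3 : ℝ) ≤ r := by exact_mod_cast hr
  have hC : 0 < Real.cos (Real.pi / r) := by
    refine Real.cos_pos_of_mem_Ioo ⟨?_, ?_⟩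
    · have : 0 < Real.pi / r := by positivity
      linarith [Real.pi_pos]
    · exact div_lt_div_of_pos_left Real.pi_pos (by norm_num) (by linarith)
  have hS : 0 < Real.sin (Real.pi / r) :=
    Real.sin_pos_of_pos_of_lt_pi (by positivity) (div_lt_self Real.pi_pos (by linarith))
  have hCS := Real.cos_sq_add_sin_sq (Real.pi / r)
  have hw := sum_cos_mul_sq_add_pos hr
  set C := Real.cos (Real.pi / r)
  set S := Real.sin (Real.pi / r)
  -- Completing the square in the real parts leads to these real parts for given imaginary parts.
  let X : (ZMod r → ℝ) →ₗ[ℝ] (ZMod r → ℝ) :=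
    S⁻¹ • (C • LinearMap.id + LinearMap.funLeft ℝ ℝ fun j => j + 1)
  refine ⟨frameMap η LinearMap.id 0, (frameMap η X LinearMap.id).comp (extendZero _),
    fun x hx => ?_, fun a ha => ?_⟩
  · refine (inner_scalarAction_frame h1 h2 h3 fun j => ⟨x j, 0⟩).trans_lt ?_
    simp only [Complex.mul_re, Complex.mul_im]
    have e : ∀ j, (-C * x (j - 1) - S * 0) * (-C * 0 + S * x (j - 1)) + x j * 0 -
        2 * (-C * x (j - 1) - S * 0) * 0 = -(C * S) * x (j - 1) ^ 2 := fun j => by ring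
    rw [Finset.sum_congr rfl fun j _ => e j, ← Finset.mul_sum, sum_shift fun j => x j ^ 2]
    obtain ⟨j, hj⟩ := Function.ne_iff.1 hx
    have : 0 < ∑ j, x j ^ 2 := Finset.sum_pos' (fun _ _ => sq_nonneg _) ⟨j, Finset.mem_univ _, by
      have : x j ≠ 0 := hj
      positivity⟩
    have := mul_pos hC hS
    nlinarith
  · rw [LinearMap.comp_apply]
    have hy := hw (extendZero _ a) (extendZero_apply_of_not a (by simp))
      (extendZero_apply_of_not a (by simp)) (extendZero_ne_zero ha)
    generalize extendZero _ a = y at hy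
    refine (inner_scalarAction_frame h1 h2 h3 fun j => ⟨X y j, y j⟩).trans_gt ?_
    have hX : ∀ j, S * X y j = C * y j + y (j + 1) := fun j => by
      simp [X, LinearMap.funLeft_apply]
      field_simp
    simp only [Complex.mul_re, Complex.mul_im]
    let g : ZMod r → ℝ := fun j => (-C * X y j - S * y j) * (-C * y j + S * X y j)
    have e1 : ∀ j, (-C * X y (j - 1) - S * y (j - 1)) * (-C * y (j - 1) + S * X y (j - 1)) +
        X y j * y j - 2 * (-C * X y (j - 1) - S * y (j - 1)) * y j =
        g (j - 1) + (X y j * y j + 2 / S * (C * y j ^ 2 + y (j - 1) * y j)) := by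
      intro j
      have := hX (j - 1)
      rw [sub_add_cancel] at this
      have e : X y (j - 1) = (C * y (j - 1) + y j) / S := by rw [← this]; field_simp
      simp only [g, e]
      field_simp
      linear_combination (2 * y j * y (j - 1)) * hCS
    have e2 : ∀ j, g j + (X y j * y j + 2 / S * (C * y j ^ 2 + y (j - 1) * y j)) =
        C / S * y j ^ 2 - C / S * y (j + 1) ^ 2 + 2 / S * (C * y j ^ 2 + y (j - 1) * y j) := by
      intro j
      have e : X y j = (C * y j + y (j + 1)) / S := by rw [← hX]; field_simp
      simp only [g, e]
      field_simp
      linear_combination (-(y j * y (j + 1))) * hCS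
    have e3 : ∑ j, C / S * y (j + 1) ^ 2 = ∑ j, C / S * y j ^ 2 := by
      rw [← sum_shift fun j => C / S * y (j + 1) ^ 2]
      simp only [sub_add_cancel]
    rw [Finset.sum_congr rfl fun j _ => e1 j, Finset.sum_add_distrib, sum_shift g,
      ← Finset.sum_add_distrib, Finset.sum_congr rfl fun j _ => e2 j, Finset.sum_add_distrib,
      Finset.sum_sub_distrib, e3, sub_self, zero_add, ← Finset.mul_sum]
    positivity

/-- Componentwise complex conjugation. -/
def conjConfig : EuclideanSpace ℂ (ZMod r) →ₗ[ℝ] EuclideanSpace ℂ (ZMod r) where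
  toFun z := WithLp.toLp 2 fun j => (starRingEnd ℂ) (z j)
  map_add' _ _ := by ext; simp
  map_smul' _ _ := by ext; simp

lemma inner_scalarAction_neg_one (z : EuclideanSpace ℂ (ZMod r)) :
    inner ℝ (scalarAction (gridRho r (-1)) (conjConfig z)) (conjConfig z) =
      -inner ℝ (scalarAction (gridRho r 1) z) z := by
  rw [gridRho_neg_one]
  exact inner_scalarAction_conj (gridRho r 1) z.ofLp

/-- The index of the form of the lines `e^{πisj/r} ℝ` is `r - 1 + s`. -/
theorem exists_scalar_eigenbasis (hodd : Odd r) (hr : 3 ≤ r) (s : SignType) (K : Type)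
    [Fintype K] (hK : (Fintype.card K : ℤ) = r - 1 + (s : ℤ)) :
    ∃ (n : ℕ) (b : OrthonormalBasis (K ⊕ Fin n) ℝ (EuclideanSpace ℂ (ZMod r)))
      (μ : K ⊕ Fin n → ℝ), (∀ i, scalarAction (gridRho r s) (b i) = μ i • b i) ∧
      (∀ i, μ (Sum.inl i) < 0) ∧ ∀ i, 0 ≤ μ (Sum.inr i) := by
  let f'' : ℂ →ₗ[ℝ] EuclideanSpace ℂ (ZMod r) :=
    { toFun := fun c => WithLp.toLp 2 fun _ => c
      map_add' := fun _ _ => rfl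
      map_smul' := fun _ _ => rfl }
  have hf'' : ∀ s a, scalarAction (gridRho r s) (f'' a) = 0 := fun s a =>
    discreteAction_const _ _ a
  have hinj : ∀ a, f'' a = 0 → a = 0 := fun a ha => by
    have h : f'' a 0 = 0 := by rw [ha]; rfl
    exact h
  have hdim : Module.finrank ℝ (EuclideanSpace ℂ (ZMod r)) = r * 2 := by
    rw [(WithLp.linearEquiv 2 ℝ (ZMod r → ℂ)).finrank_eq, Module.finrank_pi_fintype]
    simp
  have h01 : (0 : ZMod r) ≠ 1 := by
    have : Fact (1 < r) := ⟨by omega⟩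
    exact zero_ne_one
  have c1 : Fintype.card {j : ZMod r // j ≠ 0} = r - 1 := by
    rw [Fintype.card_subtype_compl, ZMod.card, Fintype.card_subtype_eq]
  have c2 : Fintype.card {j : ZMod r // j ≠ 0 ∧ j ≠ 1} = r - 2 := by
    rw [Fintype.card_subtype]
    have : (Finset.univ.filter fun j : ZMod r => j ≠ 0 ∧ j ≠ 1) = {0, 1}ᶜ := by
      ext j
      simp
    rw [this, Finset.card_compl, Finset.card_pair h01, ZMod.card]
  have hsym := scalarAction_isSymmetric (gridRho r s)
  rcases s.trichotomy with rfl | rfl | rfl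
  · obtain ⟨f, f', h1, h2⟩ := exists_definite_one (r := r) hodd hr
    refine exists_eigenbasis_of_inertia hsym (conjConfig.comp f') (conjConfig.comp f) f''
      (fun a ha => ?_) (fun a ha => ?_) (hf'' (-1)) hinj ?_ K ?_
    · exact (inner_scalarAction_neg_one (f' a)).trans_lt (neg_neg_of_pos (h2 a ha))
    · exact (inner_scalarAction_neg_one (f a)).trans_gt (neg_pos_of_neg (h1 a ha))
    · rw [hdim, Module.finrank_fintype_fun_eq_card, Module.finrank_fintype_fun_eq_card, c2,
        Complex.finrank_real_complex, ZMod.card]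
      omega
    · rw [Module.finrank_fintype_fun_eq_card, c2]
      have : (Fintype.card K : ℤ) = r - 1 + -1 := by simpa using hK
      omega
  · obtain ⟨f, f', h1, h2⟩ := exists_definite_zero (r := r)
    refine exists_eigenbasis_of_inertia hsym f f' f'' h1 h2 (hf'' 0) hinj ?_ K ?_
    · rw [hdim, Module.finrank_fintype_fun_eq_card, c1, Complex.finrank_real_complex]
      omega
    · rw [Module.finrank_fintype_fun_eq_card, c1]
      have : (Fintype.card K : ℤ) = r - 1 + 0 := by simpa using hK
      omega
  · obtain ⟨f, f', h1, h2⟩ := exists_definite_one (r := r) hodd hr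
    refine exists_eigenbasis_of_inertia hsym f f' f'' h1 h2 (hf'' 1) hinj ?_ K ?_
    · rw [hdim, Module.finrank_fintype_fun_eq_card, Module.finrank_fintype_fun_eq_card, c2,
        Complex.finrank_real_complex, ZMod.card]
      omega
    · rw [Module.finrank_fintype_fun_eq_card, ZMod.card]
      have : (Fintype.card K : ℤ) = r - 1 + 1 := by simpa using hK
      omega

end ScalarSpectrum

/-! ### The Hessian of the finite reduction -/

section Hessian

variable {ι : Type*} [Fintype ι]

lemma real_inner_eq_re (u v : EuclideanSpace ℂ ι) : inner ℝ u v = (inner ℂ u v).re := by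
  simp [PiLp.inner_apply, Complex.inner]

lemma inner_mulI (u v : EuclideanSpace ℂ ι) :
    inner ℝ (mulI _ u) v = -inner ℝ u (mulI _ v) := by
  simp [real_inner_eq_re, mulI_apply]

lemma real_inner_mulI_right (u v : EuclideanSpace ℂ ι) :
    inner ℝ u (mulI _ v) = -(inner ℂ u v).im := by
  simp [real_inner_eq_re, mulI_apply]

/-- The projection onto a Lagrangian subspace intertwines multiplication by `i` with the
complementary projection. -/
lemma Lag.starProjection_mulI (L : Lag ι) (u : EuclideanSpace ℂ ι) :
    L.1.starProjection (mulI _ u) = mulI _ (u - L.1.starProjection u) := by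
  refine Submodule.eq_starProjection_of_mem_of_inner_eq_zero ?_ fun w hw => ?_
  · refine (L.2 _).2 fun w hw => ?_
    have h : inner ℝ w (u - L.1.starProjection u) = 0 := by
      rw [real_inner_comm]
      exact Submodule.starProjection_inner_eq_zero u w hw
    rw [mulI_apply, inner_smul_right, Complex.I_mul_im, ← real_inner_eq_re]
    exact h
  · have h := (L.2 w).1 hw _ (Submodule.starProjection_apply_mem _ u)
    rw [← map_sub, sub_sub_cancel, inner_mulI, real_inner_mulI_right, h]
    simp

/-- The reflection of `ℂ^ι` in a Lagrangian subspace. -/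
def Lag.conj (L : Lag ι) : EuclideanSpace ℂ ι →ₗ[ℝ] EuclideanSpace ℂ ι :=
  (2 : ℝ) • L.1.starProjection.toLinearMap - LinearMap.id

lemma Lag.conj_apply (L : Lag ι) (u : EuclideanSpace ℂ ι) :
    L.conj u = (2 : ℝ) • L.1.starProjection u - u := rfl

lemma Lag.inner_conj (L : Lag ι) (u v : EuclideanSpace ℂ ι) :
    inner ℝ (L.conj u) v = inner ℝ u (L.conj v) := by
  simp only [Lag.conj_apply, inner_sub_left, inner_sub_right, real_inner_smul_left,
    real_inner_smul_right, Submodule.inner_starProjection_left_eq_right]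

lemma Lag.conj_mulI (L : Lag ι) (u : EuclideanSpace ℂ ι) :
    L.conj (mulI _ u) = -mulI _ (L.conj u) := by
  rw [Lag.conj_apply, Lag.conj_apply, Lag.starProjection_mulI]
  simp only [map_sub, map_smul]
  module

/-- The reflection in a Lagrangian subspace is antilinear and fixes the subspace. -/
lemma Lag.conj_smul_of_mem (L : Lag ι) {u : EuclideanSpace ℂ ι} (hu : u ∈ L.1) (c : ℂ) :
    L.conj (c • u) = (starRingEnd ℂ) c • u := by
  have h1 : L.conj u = u := by
    rw [Lag.conj_apply, Submodule.starProjection_eq_self_iff.2 hu, two_smul, add_sub_cancel_right]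
  have h2 : ∀ c : ℂ, c • u = c.re • u + c.im • mulI _ u := by
    intro c
    conv_lhs => rw [← Complex.re_add_im c, add_smul, mul_smul]
    rfl
  rw [h2 c, map_add, map_smul, map_smul, Lag.conj_mulI, h1, h2 ((starRingEnd ℂ) c)]
  simp

lemma liouville_apply (z w : EuclideanSpace ℂ ι) :
    liouville z w = ∑ k, (z k).im * (w k).re := by
  simp [liouville]

lemma liouville_lineMap (a b w : EuclideanSpace ℂ ι) (t : ℝ) :
    liouville (AffineMap.lineMap a b t) w = liouville a w + t * liouville (b - a) w := by
  simp only [liouville_apply, Finset.mul_sum, ← Finset.sum_add_distrib]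
  refine Finset.sum_congr rfl fun k _ => ?_
  simp [AffineMap.lineMap_apply]
  ring

lemma curveIntegrable_liouville_segment (a b : EuclideanSpace ℂ ι) :
    CurveIntegrable liouville (Path.segment a b) := by
  rw [curveIntegrable_segment]
  simp only [liouville_lineMap]
  exact (by fun_prop : Continuous fun t : ℝ =>
    liouville a (b - a) + t * liouville (b - a) (b - a)).intervalIntegrable _ _

lemma curveIntegral_liouville_segment (a b : EuclideanSpace ℂ ι) :
    curveIntegral liouville (Path.segment a b) =
      1 / 2 * (liouville b b - liouville a a + inner ℝ a (mulI _ b)) := by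
  rw [curveIntegral_segment]
  simp only [liouville_lineMap]
  rw [intervalIntegral.integral_add (by simp) (by
    exact (by fun_prop : Continuous fun t : ℝ =>
      t * liouville (b - a) (b - a)).intervalIntegrable _ _),
    intervalIntegral.integral_mul_const]
  simp only [intervalIntegral.integral_const, integral_id]
  simp only [liouville_apply, PiLp.inner_apply, mulI_apply, Finset.mul_sum,
    ← Finset.sum_add_distrib, ← Finset.sum_sub_distrib, smul_eq_mul]
  refine Finset.sum_congr rfl fun k _ => ?_
  simp [Complex.inner]
  ring

/-- Up to an exact term, the integral of `λ₀` over the `L`-curve is a quadratic form in the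
endpoints. -/
lemma curveIntegral_liouville_LCurve (z z'' : EuclideanSpace ℂ ι) (L : Lag ι) :
    curveIntegral liouville (LCurve z z'' L) =
      1 / 2 * (liouville z z - liouville z'' z'')
      + 1 / 2 * (inner ℝ z'' (mulI _ z) + 1 / 2 * inner ℝ (z'' - z) (mulI _ (L.conj (z'' - z)))) := by
  have halt : ∀ u : EuclideanSpace ℂ ι, inner ℝ u (mulI _ u) = 0 := by
    intro u
    have := inner_mulI u u
    rw [real_inner_comm] at this
    linarith
  rw [LCurve, curveIntegral_trans (curveIntegrable_liouville_segment _ _)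
    (curveIntegrable_liouville_segment _ _), curveIntegral_liouville_segment,
    curveIntegral_liouville_segment, Lag.conj_apply]
  obtain ⟨w, rfl⟩ : ∃ w, z'' = z + w := ⟨z'' - z, by simp⟩
  simp only [add_sub_cancel_left, map_add, map_sub, map_smul, inner_add_left, inner_add_right,
    inner_sub_right, real_inner_smul_right, halt]
  have h2 := inner_mulI (L.1.starProjection w) z
  rw [real_inner_comm] at h2
  rw [h2]
  ring

variable {r : ℕ} [NeZero r]

/-- The operator representing the Hessian of the finite reduction with `H = 0`. -/
def reductionOperator (r : ℕ) [NeZero r] (S : I → Lag ι) : Config r ι →ₗ[ℝ] Config r ι :=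
  discreteAction (mulI _) fun j => (S (gridTime r j)).conj

lemma reductionOperator_isSymmetric (S : I → Lag ι) : (reductionOperator r S).IsSymmetric :=
  discreteAction_isSymmetric _ _ inner_mulI (fun _ => Lag.inner_conj _) fun _ => Lag.conj_mulI _

lemma finiteReduction_zero (S : I → Lag ι) (z : Config r ι) :
    finiteReduction r (fun _ => 0) (fun _ z => z) S z =
      1 / 2 * inner ℝ (reductionOperator r S z) z := by
  rw [finiteReduction, reductionOperator, inner_discreteAction_self _ _ inner_mulI]
  simp only [deriv_const, map_zero, sub_zero, intervalIntegral.integral_zero, zero_add,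
    curveIntegral_liouville_LCurve]
  rw [Finset.sum_add_distrib, ← Finset.mul_sum, ← Finset.mul_sum, Finset.sum_sub_distrib,
    sum_shift fun j => liouville (z j) (z j), sub_self, mul_zero, zero_add]

theorem reductionHessian_apply (S : I → Lag ι) (u v : Config r ι) :
    reductionHessian r S u v = inner ℝ (reductionOperator r S u) v := by
  let T : Config r ι →L[ℝ] Config r ι := LinearMap.toContinuousLinearMap (reductionOperator r S)
  have hT : ∀ u v, inner ℝ (T u) v = inner ℝ u (T v) := reductionOperator_isSymmetric S
  have h1 : finiteReduction r (fun _ => 0) (fun _ z => z) S = fun z => 1 / 2 * inner ℝ (T z) z :=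
    funext fun z => finiteReduction_zero S z
  have h2 : fderiv ℝ (finiteReduction r (fun _ => 0) (fun _ z => z) S) =
      fun z => ((innerSL ℝ).comp T) z := by
    ext z w
    have : HasFDerivAt (fun z => 1 / 2 * inner ℝ (T z) z) _ z :=
      ((T.hasFDerivAt (x := z)).inner ℝ (hasFDerivAt_id z)).const_mul (1 / 2 : ℝ)
    rw [h1, HasFDerivAt.fderiv this]
    simp [hT w z, real_inner_comm w (T z)]
    ring
  rw [reductionHessian, h2]
  have : fderiv ℝ (fun z => ((innerSL ℝ).comp T) z) 0 = (innerSL ℝ).comp T :=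
    ((innerSL ℝ).comp T).fderiv
  rw [this]
  rfl

end Hessian

/-! ### Separation of variables -/

section Separation

variable {ι : Type*} [Fintype ι] {r : ℕ} [NeZero r]

/-- The configuration `ν ⊗ v = (νⱼ v)ⱼ`. -/
def tens (ν : EuclideanSpace ℂ (ZMod r)) : EuclideanSpace ℂ ι →ₗ[ℝ] Config r ι where
  toFun v := WithLp.toLp 2 fun j => ν j • v
  map_add' v w := by ext j : 1; simp
  map_smul' c v := by ext j : 1; exact smul_comm (ν j) c v

lemma tens_apply (ν : EuclideanSpace ℂ (ZMod r)) (v : EuclideanSpace ℂ ι) (j : ZMod r) :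
    tens ν v j = ν j • v := rfl

lemma tens_smul_left (c : ℝ) (ν : EuclideanSpace ℂ (ZMod r)) (v : EuclideanSpace ℂ ι) :
    tens (c • ν) v = c • tens ν v := by
  ext j : 1
  exact smul_assoc c (ν j) v

/-- The Hermitian pairing `∑ⱼ ν̄ⱼ zⱼ` of `ℂ^r` with `ℂ^r ⊗ ℂ^ι`. -/
def pairing (ν : EuclideanSpace ℂ (ZMod r)) : Config r ι →ₗ[ℝ] EuclideanSpace ℂ ι where
  toFun z := ∑ j, (starRingEnd ℂ) (ν j) • z j
  map_add' v w := by simp [Finset.sum_add_distrib]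
  map_smul' c v := by simp [smul_comm _ c, Finset.smul_sum]

lemma pairing_apply (ν : EuclideanSpace ℂ (ZMod r)) (z : Config r ι) :
    pairing ν z = ∑ j, (starRingEnd ℂ) (ν j) • z j := rfl

lemma pairing_tens (ν ν' : EuclideanSpace ℂ (ZMod r)) (v : EuclideanSpace ℂ ι) :
    pairing ν (tens ν' v) = inner ℂ ν ν' • v := by
  simp only [pairing_apply, tens_apply, smul_smul, PiLp.inner_apply, Finset.sum_smul]
  refine Finset.sum_congr rfl fun j _ => ?_
  rw [RCLike.inner_apply, mul_comm]

lemma inner_tens (ν : EuclideanSpace ℂ (ZMod r)) (v : EuclideanSpace ℂ ι) (z : Config r ι) :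
    inner ℝ (tens ν v) z = inner ℝ v (pairing ν z) := by
  rw [PiLp.inner_apply, pairing_apply, inner_sum]
  refine Finset.sum_congr rfl fun j _ => ?_
  rw [tens_apply, real_inner_eq_re, real_inner_eq_re, inner_smul_left, inner_smul_right]

/-- If the Lagrangian subspaces act on the complex line of `v` through the reflections
`c ↦ ρⱼ c̄`, the Hessian acts on the configurations `ν ⊗ v` through the scalar operator. -/
lemma reductionOperator_tens {S : I → Lag ι} {ρ : ZMod r → ℂ} {v : EuclideanSpace ℂ ι}
    (h : ∀ j (c : ℂ), (S (gridTime r j)).conj (c • v) = (ρ j * (starRingEnd ℂ) c) • v)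
    (ν : EuclideanSpace ℂ (ZMod r)) :
    reductionOperator r S (tens ν v) = tens (scalarAction ρ ν) v := by
  ext j : 1
  rw [reductionOperator, scalarAction]
  simp only [discreteAction_apply, tens_apply, ← sub_smul, h, ← add_smul, mulI_apply, conjMul_apply, smul_smul,
    smul_assoc, smul_eq_mul]

/-- A Lagrangian subspace containing `e^{iθ} v` acts on the complex line of `v` by
`c ↦ e^{2iθ} c̄`. -/
lemma Lag.conj_smul_of_exp_mem (L : Lag ι) {v : EuclideanSpace ℂ ι} {θ : ℝ}
    (h : Complex.exp (θ * Complex.I) • v ∈ L.1) (c : ℂ) :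
    L.conj (c • v) = (Complex.exp ((2 * θ : ℝ) * Complex.I) * (starRingEnd ℂ) c) • v := by
  have h1 : c • v = (c * Complex.exp (-(θ * Complex.I))) • Complex.exp (θ * Complex.I) • v := by
    rw [smul_smul, mul_assoc, ← Complex.exp_add]
    simp
  rw [h1, Lag.conj_smul_of_mem _ h, smul_smul, map_mul, ← Complex.exp_conj]
  have h2 : (2 * θ : ℝ) * Complex.I = θ * Complex.I + θ * Complex.I := by
    push_cast
    ring
  rw [h2, Complex.exp_add]
  simp only [map_neg, map_mul, Complex.conj_ofReal, Complex.conj_I, mul_neg, neg_neg]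
  congr 1
  ring

/-- Real subspaces `V τ ⊂ ℂ^ι` whose complexifications form an orthogonal decomposition
of `ℂ^ι`. -/
structure IsRealSplitting {κ : Type*} [Fintype κ] (V : κ → Submodule ℝ (EuclideanSpace ℂ ι)) :
    Prop where
  ortho : ∀ τ τ', τ ≠ τ' → ∀ u ∈ V τ, ∀ v ∈ V τ', inner ℂ u v = 0
  isotropic : ∀ τ, ∀ u ∈ V τ, ∀ v ∈ V τ, (inner ℂ u v).im = 0
  total : ∀ w, ∑ τ, ((V τ).starProjection w -
    mulI _ ((V τ).starProjection (mulI _ w))) = w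

variable {κ : Type*} [Fintype κ] {V : κ → Submodule ℝ (EuclideanSpace ℂ ι)}

lemma IsRealSplitting.starProjection_smul (hV : IsRealSplitting V) {τ : κ}
    {v : EuclideanSpace ℂ ι} (hv : v ∈ V τ) (c : ℂ) :
    (V τ).starProjection (c • v) = c.re • v := by
  refine Submodule.eq_starProjection_of_mem_of_inner_eq_zero (Submodule.smul_mem _ _ hv)
    fun w hw => ?_
  have h := hV.isotropic τ v hv w hw
  rw [inner_sub_left, real_inner_smul_left, real_inner_eq_re, real_inner_eq_re, inner_smul_left,
    Complex.mul_re, h]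
  simp

lemma IsRealSplitting.starProjection_smul_of_ne (hV : IsRealSplitting V) {τ τ' : κ} (hτ : τ ≠ τ')
    {v : EuclideanSpace ℂ ι} (hv : v ∈ V τ') (c : ℂ) :
    (V τ).starProjection (c • v) = 0 := by
  refine Submodule.eq_starProjection_of_mem_of_inner_eq_zero (Submodule.zero_mem _) fun w hw => ?_
  rw [sub_zero, real_inner_eq_re, inner_smul_left, hV.ortho τ' τ hτ.symm v hv w hw]
  simp

lemma real_inner_eq_re_zmod (ν ν' : EuclideanSpace ℂ (ZMod r)) :
    (inner ℂ ν ν').re = inner ℝ ν ν' := (real_inner_eq_re ν ν').symm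

variable {K : κ → Type*} [∀ τ, Fintype (K τ)]

/-- The coefficients of a configuration with respect to a family of bases of `ℂ^r`. -/
lemma IsRealSplitting.starProjection_pairing_tens (hV : IsRealSplitting V)
    [∀ τ, DecidableEq (K τ)] [DecidableEq κ]
    (b : ∀ τ, OrthonormalBasis (K τ) ℝ (EuclideanSpace ℂ (ZMod r)))
    (k k' : Σ τ, K τ) {v : EuclideanSpace ℂ ι} (hv : v ∈ V k'.1) :
    (V k.1).starProjection (pairing (b k.1 k.2) (tens (b k'.1 k'.2) v)) =
      if k = k' then v else 0 := by
  obtain ⟨τ, k⟩ := k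
  obtain ⟨τ', k'⟩ := k'
  rw [pairing_tens]
  by_cases h : τ = τ'
  · subst h
    rw [hV.starProjection_smul hv, real_inner_eq_re_zmod, (b τ).inner_eq_ite]
    by_cases hk : k = k' <;> simp [hk]
  · rw [hV.starProjection_smul_of_ne h hv, if_neg]
    rintro ⟨⟩
    exact h rfl

/-- Every configuration is the sum of its components `b ⊗ v` with `v ∈ V τ`. -/
lemma IsRealSplitting.sum_tens (hV : IsRealSplitting V)
    (b : ∀ τ, OrthonormalBasis (K τ) ℝ (EuclideanSpace ℂ (ZMod r))) (z : Config r ι) :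
    ∑ τ, ∑ k, tens (b τ k) ((V τ).starProjection (pairing (b τ k) z)) = z := by
  classical
  ext i : 1
  rw [← hV.total (z i)]
  simp only [WithLp.ofLp_sum, Finset.sum_apply]
  refine Finset.sum_congr rfl fun τ _ => ?_
  -- The coordinate vectors `1` and `i` at `j`, expanded in the basis `b τ`.
  have hb : ∀ (j : ZMod r) (c : ℂ), ∑ k, (inner ℝ c (b τ k j)) • b τ k i =
      if i = j then c else 0 := by
    intro j c
    have h := congrArg (fun ν : EuclideanSpace ℂ (ZMod r) => ν i)
      ((b τ).sum_repr' (EuclideanSpace.single j c))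
    simp only [WithLp.ofLp_sum, Finset.sum_apply, PiLp.smul_apply, PiLp.single_apply] at h
    rw [← h]
    refine Finset.sum_congr rfl fun k _ => ?_
    congr 1
    rw [real_inner_comm, PiLp.inner_apply, Finset.sum_eq_single j]
    · simp
    · intro l _ hl
      simp [hl]
    · simp
  have hp : ∀ k, (V τ).starProjection (pairing (b τ k) z) =
      ∑ j, ((inner ℝ 1 (b τ k j)) • (V τ).starProjection (z j)
        - (inner ℝ Complex.I (b τ k j)) • (V τ).starProjection (mulI _ (z j))) := by
    intro k
    rw [pairing_apply, map_sum]
    refine Finset.sum_congr rfl fun j _ => ?_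
    rw [← map_smul, ← map_smul, ← map_sub]
    congr 1
    have : (starRingEnd ℂ) (b τ k j) = ((b τ k j).re : ℂ) - (b τ k j).im * Complex.I := by
      apply Complex.ext <;> simp
    rw [this, sub_smul, mul_smul]
    simp only [Complex.inner, mulI_apply, Complex.coe_smul]
    simp
  simp only [tens_apply, hp, Finset.smul_sum, smul_sub]
  rw [Finset.sum_comm]
  have h1 : ∀ j, ∑ k, (b τ k i • (inner ℝ 1 (b τ k j)) • (V τ).starProjection (z j)
      - b τ k i • (inner ℝ Complex.I (b τ k j)) • (V τ).starProjection (mulI _ (z j))) =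
      if i = j then (V τ).starProjection (z j) - mulI _ ((V τ).starProjection (mulI _ (z j)))
        else 0 := by
    intro j
    have e : ∀ (c : ℂ) (v : EuclideanSpace ℂ ι), ∑ k, b τ k i • (inner ℝ c (b τ k j)) • v =
        (if i = j then c else 0) • v := by
      intro c v
      rw [← hb j c, Finset.sum_smul]
      refine Finset.sum_congr rfl fun k _ => ?_
      rw [smul_comm, smul_assoc]
    rw [Finset.sum_sub_distrib, e, e]
    by_cases h : i = j <;> simp [h, mulI_apply]
  rw [Finset.sum_congr rfl fun j _ => h1 j]
  simp

lemma negEigenspace_reductionHessian (S : I → Lag ι) :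
    negEigenspace (reductionHessian r S) =
      Submodule.span ℝ {u | ∃ μ : ℝ, μ < 0 ∧ reductionOperator r S u = μ • u} := by
  rw [negEigenspace]
  congr 1
  ext u
  refine exists_congr fun μ => and_congr_right fun _ => ?_
  simp only [reductionHessian_apply, ← real_inner_smul_left]
  exact ⟨fun h => ext_inner_right ℝ h, fun h v => by rw [h]⟩

/-- Eigenvectors with nonnegative eigenvalue are orthogonal to the negative eigenspace. -/
lemma inner_eq_zero_of_mem_negEigenspace {S : I → Lag ι} {u z : Config r ι} {μ : ℝ}
    (hu : reductionOperator r S u = μ • u) (hμ : 0 ≤ μ)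
    (hz : z ∈ negEigenspace (reductionHessian r S)) : inner ℝ u z = 0 := by
  rw [negEigenspace_reductionHessian] at hz
  induction hz using Submodule.span_induction with
  | mem z hz =>
    obtain ⟨μ', hμ', hz⟩ := hz
    have h := reductionOperator_isSymmetric S u z
    rw [hu, hz, real_inner_smul_left, real_inner_smul_right] at h
    have h' : (μ - μ') * inner ℝ u z = 0 := by rw [sub_mul, h, sub_self]
    exact (mul_eq_zero.1 h').resolve_left (by linarith)
  | zero => exact inner_zero_right _
  | add z z' _ _ h h' => rw [inner_add_right, h, h', add_zero]
  | smul c z _ h => rw [real_inner_smul_right, h, mul_zero]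

variable {N : κ → Type*} [∀ τ, Fintype (N τ)]
  {b : ∀ τ, OrthonormalBasis (K τ ⊕ N τ) ℝ (EuclideanSpace ℂ (ZMod r))}
  {μ : ∀ τ, K τ ⊕ N τ → ℝ} {ρ : κ → ZMod r → ℂ} {S : I → Lag ι}

lemma tens_mem_negEigenspace
    (hS : ∀ τ, ∀ v ∈ V τ, ∀ j (c : ℂ),
      (S (gridTime r j)).conj (c • v) = (ρ τ j * (starRingEnd ℂ) c) • v)
    (hb : ∀ τ k, scalarAction (ρ τ) (b τ k) = μ τ k • b τ k) (hμ : ∀ τ k, μ τ (Sum.inl k) < 0)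
    (τ : κ) (k : K τ) {v : EuclideanSpace ℂ ι} (hv : v ∈ V τ) :
    tens (b τ (Sum.inl k)) v ∈ negEigenspace (reductionHessian r S) := by
  rw [negEigenspace_reductionHessian]
  refine Submodule.subset_span ⟨μ τ (Sum.inl k), hμ τ k, ?_⟩
  rw [reductionOperator_tens (hS τ v hv), hb, tens_smul_left]

/-- A vector of the negative eigenspace is the sum of its components along the negative scalar
eigenvectors. -/
lemma IsRealSplitting.sum_tens_of_mem_negEigenspace (hV : IsRealSplitting V)
    (hS : ∀ τ, ∀ v ∈ V τ, ∀ j (c : ℂ),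
      (S (gridTime r j)).conj (c • v) = (ρ τ j * (starRingEnd ℂ) c) • v)
    (hb : ∀ τ k, scalarAction (ρ τ) (b τ k) = μ τ k • b τ k) (hμ : ∀ τ k, 0 ≤ μ τ (Sum.inr k))
    {z : Config r ι} (hz : z ∈ negEigenspace (reductionHessian r S)) :
    ∑ k : Σ τ, K τ, tens (b k.1 (Sum.inl k.2))
      ((V k.1).starProjection (pairing (b k.1 (Sum.inl k.2)) z)) = z := by
  conv_rhs => rw [← hV.sum_tens b z]
  rw [Fintype.sum_sigma]
  refine Finset.sum_congr rfl fun τ _ => ?_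
  rw [Fintype.sum_sum_type, left_eq_add]
  refine Finset.sum_eq_zero fun k _ => ?_
  suffices h : (V τ).starProjection (pairing (b τ (Sum.inr k)) z) = 0 by rw [h, map_zero]
  set p := pairing (b τ (Sum.inr k)) z
  have hp : (V τ).starProjection p ∈ V τ := Submodule.starProjection_apply_mem _ _
  have h0 : inner ℝ (tens (b τ (Sum.inr k)) ((V τ).starProjection p)) z = 0 := by
    refine inner_eq_zero_of_mem_negEigenspace (μ := μ τ (Sum.inr k)) ?_ (hμ τ k) hz
    rw [reductionOperator_tens (hS τ _ hp), hb, tens_smul_left]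
  rw [inner_tens, ← Submodule.starProjection_eq_self_iff.2 hp,
    Submodule.inner_starProjection_left_eq_right] at h0
  exact inner_self_eq_zero.1 h0

end Separation

/-! ### The real splitting defined by a point of the base -/

section RealParts

variable {ι κ : Type*} [Fintype ι] [Fintype κ]

/-- The inclusion `ℝ^ι ⊂ ℂ^ι`. -/
def ofRealVec : EuclideanSpace ℝ ι →ₗ[ℝ] EuclideanSpace ℂ ι where
  toFun v := WithLp.toLp 2 fun k => (v k : ℂ)
  map_add' u v := by ext k; simp
  map_smul' c v := by ext k; simp

/-- The real part of a vector of `ℂ^ι`. -/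
def reVec : EuclideanSpace ℂ ι →ₗ[ℝ] EuclideanSpace ℝ ι where
  toFun v := WithLp.toLp 2 fun k => (v k).re
  map_add' u v := by ext k; simp
  map_smul' c v := by ext k; simp

/-- The imaginary part of a vector of `ℂ^ι`. -/
def imVec : EuclideanSpace ℂ ι →ₗ[ℝ] EuclideanSpace ℝ ι where
  toFun v := WithLp.toLp 2 fun k => (v k).im
  map_add' u v := by ext k; simp
  map_smul' c v := by ext k; simp

/-- The inclusion of the first summand of `ℂ^ι ⊕ ℂ^κ`. -/
def inlC : EuclideanSpace ℂ ι →ₗ[ℝ] EuclideanSpace ℂ (ι ⊕ κ) where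
  toFun v := WithLp.toLp 2 (Sum.elim v 0)
  map_add' u v := by ext (k | k) <;> simp
  map_smul' c v := by ext (k | k) <;> simp

/-- The inclusion of the second summand of `ℂ^ι ⊕ ℂ^κ`. -/
def inrC : EuclideanSpace ℂ κ →ₗ[ℝ] EuclideanSpace ℂ (ι ⊕ κ) where
  toFun v := WithLp.toLp 2 (Sum.elim 0 v)
  map_add' u v := by ext (k | k) <;> simp
  map_smul' c v := by ext (k | k) <;> simp

@[simp] lemma ofRealVec_apply (v : EuclideanSpace ℝ ι) (k : ι) : ofRealVec v k = (v k : ℂ) := rfl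

@[simp] lemma reVec_apply (v : EuclideanSpace ℂ ι) (k : ι) : reVec v k = (v k).re := rfl

@[simp] lemma imVec_apply (v : EuclideanSpace ℂ ι) (k : ι) : imVec v k = (v k).im := rfl

@[simp] lemma reVec_ofRealVec (v : EuclideanSpace ℝ ι) : reVec (ofRealVec v) = v := by
  ext k
  simp

@[simp] lemma fstC_inlC (v : EuclideanSpace ℂ ι) :
    fstC (inlC v : EuclideanSpace ℂ (ι ⊕ κ)) = v := rfl

@[simp] lemma sndC_inlC (v : EuclideanSpace ℂ ι) :
    sndC (inlC v : EuclideanSpace ℂ (ι ⊕ κ)) = 0 := rfl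

@[simp] lemma fstC_inrC (v : EuclideanSpace ℂ κ) :
    fstC (inrC v : EuclideanSpace ℂ (ι ⊕ κ)) = 0 := rfl

@[simp] lemma sndC_inrC (v : EuclideanSpace ℂ κ) :
    sndC (inrC v : EuclideanSpace ℂ (ι ⊕ κ)) = v := rfl

lemma ext_fstC_sndC {v w : EuclideanSpace ℂ (ι ⊕ κ)} (h1 : fstC v = fstC w)
    (h2 : sndC v = sndC w) : v = w := by
  ext (k | k)
  · exact congrArg (fun u : EuclideanSpace ℂ ι => u k) h1
  · exact congrArg (fun u : EuclideanSpace ℂ κ => u k) h2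

lemma fstC_smul (c : ℂ) (v : EuclideanSpace ℂ (ι ⊕ κ)) : fstC (c • v) = c • fstC v := rfl

lemma sndC_smul (c : ℂ) (v : EuclideanSpace ℂ (ι ⊕ κ)) : sndC (c • v) = c • sndC v := rfl

lemma inner_ofRealVec (u v : EuclideanSpace ℝ ι) :
    inner ℂ (ofRealVec u) (ofRealVec v) = (inner ℝ u v : ℝ) := by
  simp [PiLp.inner_apply]

lemma real_inner_ofRealVec_right (w : EuclideanSpace ℂ ι) (v : EuclideanSpace ℝ ι) :
    inner ℝ w (ofRealVec v) = inner ℝ (reVec w) v := by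
  simp [PiLp.inner_apply, Complex.inner]

lemma exp_smul_ofRealVec (θ : ℝ) (v : EuclideanSpace ℝ ι) :
    Complex.exp (θ * Complex.I) • ofRealVec v = rot θ v := rfl

end RealParts

section Parts

variable {ι : Type*} [Fintype ι]

/-- The subspaces `V₀`, `V₊`, `V₋` of a triple, indexed by their sign. -/
def Triple.part (T : Triple ι) : SignType → Submodule ℝ (EuclideanSpace ℝ ι)
  | .zero => T.zero
  | .neg => T.minus
  | .pos => T.plus

lemma Triple.part_isOrtho (T : Triple ι) {s s' : SignType} (h : s ≠ s') : T.part s ⟂ T.part s' := by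
  rcases s with _ | _ | _ <;> rcases s' with _ | _ | _
  exacts [absurd rfl h, T.minus_zero.symm, T.plus_zero.symm, T.minus_zero, absurd rfl h,
    T.plus_minus.symm, T.plus_zero, T.plus_minus, absurd rfl h]

/-- The projections onto the three subspaces of a triple. -/
def Triple.proj (T : Triple ι) (s : SignType) : EuclideanSpace ℝ ι →L[ℝ] EuclideanSpace ℝ ι :=
  (T.part s).starProjection

lemma Triple.proj_mem (T : Triple ι) (s : SignType) (v : EuclideanSpace ℝ ι) :
    T.proj s v ∈ T.part s := Submodule.starProjection_apply_mem _ _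

lemma Triple.proj_of_mem (T : Triple ι) {s : SignType} {v : EuclideanSpace ℝ ι}
    (hv : v ∈ T.part s) : T.proj s v = v := Submodule.starProjection_eq_self_iff.2 hv

lemma Triple.proj_of_mem_of_ne (T : Triple ι) {s s' : SignType} (h : s ≠ s')
    {v : EuclideanSpace ℝ ι} (hv : v ∈ T.part s') : T.proj s v = 0 :=
  Submodule.eq_starProjection_of_mem_of_inner_eq_zero (Submodule.zero_mem _) fun w hw => by
    rw [sub_zero, real_inner_comm]
    exact Submodule.isOrtho_iff_inner_eq.1 (T.part_isOrtho h) w hw v hv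

lemma Triple.exists_parts (T : Triple ι) (v : EuclideanSpace ℝ ι) :
    ∃ a ∈ T.part 1, ∃ b ∈ T.part (-1), ∃ c ∈ T.part 0, a + b + c = v := by
  have h : v ∈ T.plus ⊔ T.minus ⊔ T.zero := T.sup_eq_top ▸ Submodule.mem_top
  obtain ⟨x, hx, c, hc, rfl⟩ := Submodule.mem_sup.1 h
  obtain ⟨a, ha, b, hb, rfl⟩ := Submodule.mem_sup.1 hx
  exact ⟨a, ha, b, hb, c, hc, rfl⟩

lemma Triple.proj_add_proj (T : Triple ι) (v : EuclideanSpace ℝ ι) :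
    T.proj 1 v + T.proj (-1) v + T.proj 0 v = v := by
  obtain ⟨a, ha, b, hb, c, hc, rfl⟩ := T.exists_parts v
  simp only [map_add, T.proj_of_mem ha, T.proj_of_mem hb, T.proj_of_mem hc,
    T.proj_of_mem_of_ne (show (1 : SignType) ≠ -1 by decide) hb,
    T.proj_of_mem_of_ne (show (1 : SignType) ≠ 0 by decide) hc,
    T.proj_of_mem_of_ne (show (-1 : SignType) ≠ 1 by decide) ha,
    T.proj_of_mem_of_ne (show (-1 : SignType) ≠ 0 by decide) hc,
    T.proj_of_mem_of_ne (show (0 : SignType) ≠ 1 by decide) ha,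
    T.proj_of_mem_of_ne (show (0 : SignType) ≠ -1 by decide) hb]
  simp

lemma Triple.rot_mem_curve (T : Triple ι) {s : SignType} {v : EuclideanSpace ℝ ι}
    (hv : v ∈ T.part s) (t : ℝ) : rot (s * (Real.pi * t)) v ∈ T.curve t := by
  rcases s.trichotomy with rfl | rfl | rfl
  · refine Submodule.mem_sup_left (Submodule.mem_sup_right ⟨v, hv, ?_⟩)
    simp
  · refine Submodule.mem_sup_right ⟨v, hv, ?_⟩
    simp
  · refine Submodule.mem_sup_left (Submodule.mem_sup_left ⟨v, hv, ?_⟩)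
    simp

lemma StdLoop.apply_eq_curve (γ : StdLoop ι) (t : I) : (γ.1.1 t).1 = γ.triple.curve t :=
  γ.2.choose_spec t

/-- The reflection in the Lagrangian subspace at time `1/4` is the identity on `V₀`, and
multiplication by `± i` on `V_±`. -/
lemma StdLoop.conj_quarter (γ : StdLoop ι) (v : EuclideanSpace ℝ ι) :
    (γ.1.1 ⟨1 / 4, by norm_num, by norm_num⟩).conj (ofRealVec v) =
      ofRealVec (γ.triple.proj 0 v) +
        mulI _ (ofRealVec (γ.triple.proj 1 v - γ.triple.proj (-1) v)) := by
  have h : ∀ s : SignType, ∀ u ∈ γ.triple.part s,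
      (γ.1.1 ⟨1 / 4, by norm_num, by norm_num⟩).conj (ofRealVec u) =
        Complex.exp ((s * (Real.pi / 2) : ℝ) * Complex.I) • ofRealVec u := by
    intro s u hu
    have h1 : Complex.exp ((s * (Real.pi * (1 / 4)) : ℝ) * Complex.I) • ofRealVec u ∈
        (γ.1.1 ⟨1 / 4, by norm_num, by norm_num⟩).1 := by
      rw [γ.apply_eq_curve, exp_smul_ofRealVec]
      exact γ.triple.rot_mem_curve hu _
    have h2 := Lag.conj_smul_of_exp_mem _ h1 1
    rw [one_smul, map_one, mul_one] at h2
    rw [h2]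
    congr 4
    ring
  conv_lhs => rw [← γ.triple.proj_add_proj v]
  rw [map_add, map_add, map_add, map_add, h 1 _ (γ.triple.proj_mem _ _),
    h (-1) _ (γ.triple.proj_mem _ _), h 0 _ (γ.triple.proj_mem _ _)]
  have e1 : Complex.exp ((((1 : SignType) : ℝ) * (Real.pi / 2) : ℝ) * Complex.I) = Complex.I := by
    simp [Complex.exp_pi_div_two_mul_I]
  have e2 : Complex.exp ((((-1 : SignType) : ℝ) * (Real.pi / 2) : ℝ) * Complex.I) =
      -Complex.I := by
    have : (((-1 : SignType) : ℝ) * (Real.pi / 2) : ℝ) * Complex.I = -(Real.pi / 2 * Complex.I) := by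
      simp
    rw [this, Complex.exp_neg, Complex.exp_pi_div_two_mul_I, Complex.inv_I]
  have e3 : Complex.exp ((((0 : SignType) : ℝ) * (Real.pi / 2) : ℝ) * Complex.I) = 1 := by
    simp
  rw [e1, e2, e3, map_sub, map_sub, mulI_apply, mulI_apply]
  module

lemma Lag.continuous_conj_apply (u : EuclideanSpace ℂ ι) :
    Continuous fun L : Lag ι => L.conj u := by
  have h : Continuous fun L : Lag ι => L.1.starProjection := continuous_induced_dom
  have h' : Continuous fun L : Lag ι => L.1.starProjection u := h.clm_apply continuous_const
  simp only [Lag.conj_apply]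
  exact (h'.const_smul (2 : ℝ)).sub continuous_const

/-- The canonical bundles are subbundles: the projections onto `V₀`, `V₊`, `V₋` depend continuously
on the loop, as they can be read off from its value at time `1/4`. -/
lemma StdLoop.continuous_proj (s : SignType) (v : EuclideanSpace ℝ ι) :
    Continuous fun γ : StdLoop ι => γ.triple.proj s v := by
  have h : Continuous fun γ : StdLoop ι =>
      (γ.1.1 ⟨1 / 4, by norm_num, by norm_num⟩).conj (ofRealVec v) :=
    (Lag.continuous_conj_apply _).comp ((continuous_eval_const _).comp
      (continuous_subtype_val.comp continuous_subtype_val))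
  simp only [StdLoop.conj_quarter] at h
  have hre : Continuous fun γ : StdLoop ι => γ.triple.proj 0 v := by
    refine ((reVec (ι := ι)).continuous_of_finiteDimensional.comp h).congr fun γ => ?_
    ext k
    simp [mulI_apply]
  have him : Continuous fun γ : StdLoop ι => γ.triple.proj 1 v - γ.triple.proj (-1) v := by
    refine ((imVec (ι := ι)).continuous_of_finiteDimensional.comp h).congr fun γ => ?_
    ext k
    simp [mulI_apply]
  have hsum : ∀ γ : StdLoop ι,
      v - γ.triple.proj 0 v = γ.triple.proj 1 v + γ.triple.proj (-1) v := fun γ => by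
    rw [sub_eq_iff_eq_add]
    exact (γ.triple.proj_add_proj v).symm
  rcases s.trichotomy with rfl | rfl | rfl
  · refine ((((continuous_const (y := v)).sub hre).sub him).const_smul (1 / 2 : ℝ)).congr
      fun γ => ?_
    simp only [Pi.smul_apply, Pi.sub_apply]
    rw [hsum γ]
    module
  · exact hre
  · refine ((((continuous_const (y := v)).sub hre).add him).const_smul (1 / 2 : ℝ)).congr
      fun γ => ?_
    simp only [Pi.smul_apply, Pi.sub_apply, Pi.add_apply]
    rw [hsum γ]
    module

end Parts

section Splitting

variable {n₁ n₂ : ℕ}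

/-- The subspaces `L`, `V₀`, `V₊`, `V₋` of `ℂ^{n₁} ⊕ ℂ^{n₂}` given by a point of the base. -/
def Base.split (x : Base n₁ n₂) :
    Option SignType → Submodule ℝ (EuclideanSpace ℂ (Fin n₁ ⊕ Fin n₂))
  | none => x.1.1.map inlC
  | some s => (x.2.triple.part s).map (inrC.comp ofRealVec)

lemma Base.starProjection_split_none (x : Base n₁ n₂) (w : EuclideanSpace ℂ (Fin n₁ ⊕ Fin n₂)) :
    (x.split none).starProjection w = inlC (x.1.1.starProjection (fstC w)) := by
  refine Submodule.eq_starProjection_of_mem_of_inner_eq_zero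
    ⟨_, Submodule.starProjection_apply_mem _ _, rfl⟩ ?_
  rintro _ ⟨u, hu, rfl⟩
  rw [real_inner_eq_re, inner_sum_split, map_sub, map_sub, fstC_inlC, fstC_inlC, sndC_inlC,
    sndC_inlC, inner_zero_right, add_zero, ← real_inner_eq_re]
  exact Submodule.starProjection_inner_eq_zero _ _ hu

lemma Base.starProjection_split_some (x : Base n₁ n₂) (s : SignType)
    (w : EuclideanSpace ℂ (Fin n₁ ⊕ Fin n₂)) :
    (x.split (some s)).starProjection w =
      inrC (ofRealVec (x.2.triple.proj s (reVec (sndC w)))) := by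
  refine Submodule.eq_starProjection_of_mem_of_inner_eq_zero
    ⟨_, x.2.triple.proj_mem _ _, rfl⟩ ?_
  rintro _ ⟨u, hu, rfl⟩
  rw [LinearMap.comp_apply, real_inner_eq_re, inner_sum_split, map_sub, map_sub, fstC_inrC,
    fstC_inrC, sndC_inrC, sndC_inrC, inner_zero_right, zero_add, ← real_inner_eq_re,
    real_inner_ofRealVec_right, map_sub, reVec_ofRealVec]
  exact Submodule.starProjection_inner_eq_zero _ _ hu

lemma Base.continuous_starProjection_split (τ : Option SignType)
    (w : EuclideanSpace ℂ (Fin n₁ ⊕ Fin n₂)) :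
    Continuous fun x : Base n₁ n₂ => (x.split τ).starProjection w := by
  rcases τ with _ | s
  · simp only [Base.starProjection_split_none]
    have h : Continuous fun L : Lag (Fin n₁) => L.1.starProjection := continuous_induced_dom
    exact (inlC (κ := Fin n₂)).continuous_of_finiteDimensional.comp
      ((h.clm_apply continuous_const).comp continuous_fst)
  · simp only [Base.starProjection_split_some]
    exact (inrC (ι := Fin n₁)).continuous_of_finiteDimensional.comp
      (ofRealVec.continuous_of_finiteDimensional.comp
        ((StdLoop.continuous_proj s _).comp continuous_snd))

lemma Base.isRealSplitting (x : Base n₁ n₂) : IsRealSplitting x.split where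
  ortho := by
    rintro (_ | s) (_ | s') h
    · exact absurd rfl h
    · rintro _ ⟨u, hu, rfl⟩ _ ⟨v, hv, rfl⟩
      simp [inner_sum_split]
    · rintro _ ⟨u, hu, rfl⟩ _ ⟨v, hv, rfl⟩
      simp [inner_sum_split]
    · rintro _ ⟨u, hu, rfl⟩ _ ⟨v, hv, rfl⟩
      have h' : s ≠ s' := fun e => h (congrArg some e)
      have := Submodule.isOrtho_iff_inner_eq.1 (x.2.triple.part_isOrtho h') u hu v hv
      simp [inner_sum_split, inner_ofRealVec, this]
  isotropic := by
    rintro (_ | s)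
    · rintro _ ⟨u, hu, rfl⟩ _ ⟨v, hv, rfl⟩
      rw [inner_sum_split, fstC_inlC, fstC_inlC, sndC_inlC, inner_zero_left, add_zero]
      exact (x.1.2 v).1 hv u hu
    · rintro _ ⟨u, hu, rfl⟩ _ ⟨v, hv, rfl⟩
      simp [inner_sum_split, inner_ofRealVec]
  total := by
    intro w
    have hJ1 : fstC (mulI _ w) = mulI _ (fstC w) := rfl
    have hJ2 : sndC (mulI _ w) = mulI _ (sndC w) := rfl
    have hJ1' : ∀ v : EuclideanSpace ℂ (Fin n₁),
      mulI _ (inlC v : EuclideanSpace ℂ (Fin n₁ ⊕ Fin n₂)) = inlC (mulI _ v) := fun v =>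
        ext_fstC_sndC rfl (by simp [mulI_apply, sndC_smul])
    have hJ2' : ∀ v : EuclideanSpace ℂ (Fin n₂),
      mulI _ (inrC v : EuclideanSpace ℂ (Fin n₁ ⊕ Fin n₂)) = inrC (mulI _ v) := fun v =>
        ext_fstC_sndC (by simp [mulI_apply, fstC_smul]) rfl
    have huniv : (Finset.univ : Finset SignType) = {1, -1, 0} := by decide
    have hsum : ∀ v, ∑ s, x.2.triple.proj s v = v := fun v => by
      rw [huniv, Finset.sum_insert (by decide), Finset.sum_pair (by decide), ← add_assoc]
      exact x.2.triple.proj_add_proj v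
    rw [Fintype.sum_option]
    simp only [Base.starProjection_split_none, Base.starProjection_split_some, hJ1, hJ2, hJ1',
      hJ2', ← map_sub]
    rw [← map_sum, Finset.sum_sub_distrib, ← map_sum, ← map_sum, ← map_sum, hsum, hsum,
      Lag.starProjection_mulI]
    refine ext_fstC_sndC ?_ ?_
    · ext k
      simp [mulI_apply, ← mul_assoc]
    · ext k
      apply Complex.ext <;> simp [mulI_apply]

lemma Base.conj_loop_smul {r : ℕ} [NeZero r] (x : Base n₁ n₂) (τ : Option SignType)
    (v : EuclideanSpace ℂ (Fin n₁ ⊕ Fin n₂)) (hv : v ∈ x.split τ) (j : ZMod r) (c : ℂ) :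
    (x.loop (gridTime r j)).conj (c • v) =
      (gridRho r (τ.getD 0) j * (starRingEnd ℂ) c) • v := by
  refine Lag.conj_smul_of_exp_mem _ ?_ c
  rcases τ with _ | s
  · obtain ⟨u, hu, rfl⟩ := hv
    refine ⟨?_, ?_⟩
    · simp only [Option.getD_none, SignType.coe_zero, zero_mul, Complex.ofReal_zero,
        Complex.exp_zero, one_smul]
      exact hu
    · rw [SetLike.mem_coe, Submodule.mem_comap, sndC_smul, sndC_inlC, smul_zero]
      exact Submodule.zero_mem _
  · obtain ⟨u, hu, rfl⟩ := hv
    refine ⟨?_, ?_⟩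
    · rw [SetLike.mem_coe, Submodule.mem_comap, fstC_smul, LinearMap.comp_apply, fstC_inrC,
        smul_zero]
      exact Submodule.zero_mem _
    · rw [SetLike.mem_coe, Submodule.mem_comap, sndC_smul, LinearMap.comp_apply, sndC_inrC,
        exp_smul_ofRealVec, StdLoop.apply_eq_curve]
      exact x.2.triple.rot_mem_curve hu _

end Splitting

/-! ### Isomorphisms of families of subspaces -/

section BundleCalculus

variable {X E E' E'' F F' : Type*} [TopologicalSpace X]
  [AddCommGroup E] [Module ℝ E] [TopologicalSpace E]
  [AddCommGroup E'] [Module ℝ E'] [TopologicalSpace E']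
  [AddCommGroup E''] [Module ℝ E''] [TopologicalSpace E'']
  [AddCommGroup F] [Module ℝ F] [TopologicalSpace F]
  {W : X → Submodule ℝ E} {W' : X → Submodule ℝ E'} {W'' : X → Submodule ℝ E''}

/-- An isomorphism of families of subspaces given by families of maps of the ambient spaces. -/
def BundleIso.ofMaps (f : X → E →ₗ[ℝ] E') (g : X → E' → E)
    (hf : Continuous fun p : X × E => f p.1 p.2) (hg : Continuous fun p : X × E' => g p.1 p.2)
    (hfW : ∀ x, ∀ v ∈ W x, f x v ∈ W' x) (hgW : ∀ x, ∀ v ∈ W' x, g x v ∈ W x)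
    (hgf : ∀ x, ∀ v ∈ W x, g x (f x v) = v) (hfg : ∀ x, ∀ v ∈ W' x, f x (g x v) = v) :
    BundleIso W W' where
  equiv x :=
    { toFun := fun v => ⟨f x v, hfW x v v.2⟩
      map_add' := fun u v => Subtype.ext (map_add (f x) (u : E) v)
      map_smul' := fun c v => Subtype.ext (map_smul (f x) c (v : E))
      invFun := fun v => ⟨g x v, hgW x v v.2⟩
      left_inv := fun v => Subtype.ext (hgf x v v.2)
      right_inv := fun v => Subtype.ext (hfg x v v.2) }
  continuous_equiv := hf.comp continuous_subtype_val
  continuous_symm := hg.comp continuous_subtype_val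

/-- The inverse of an isomorphism of families of subspaces. -/
def BundleIso.symm (e : BundleIso W W') : BundleIso W' W where
  equiv x := (e.equiv x).symm
  continuous_equiv := e.continuous_symm
  continuous_symm := e.continuous_equiv

/-- The composition of isomorphisms of families of subspaces. -/
def BundleIso.trans (e : BundleIso W W') (e' : BundleIso W' W'') : BundleIso W W'' where
  equiv x := (e.equiv x).trans (e'.equiv x)
  continuous_equiv := e'.continuous_equiv.comp
    (f := fun p : Total W => (⟨(p.1.1, e.equiv p.1.1 ⟨p.1.2, p.2⟩), Subtype.coe_prop _⟩ : Total W'))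
    (((continuous_fst.comp continuous_subtype_val).prodMk e.continuous_equiv).subtype_mk _)
  continuous_symm := e.continuous_symm.comp
    (f := fun p : Total W'' =>
      (⟨(p.1.1, (e'.equiv p.1.1).symm ⟨p.1.2, p.2⟩), Subtype.coe_prop _⟩ : Total W'))
    (((continuous_fst.comp continuous_subtype_val).prodMk e'.continuous_symm).subtype_mk _)

/-- The direct sum of an isomorphism with the identity of another family. -/
def BundleIso.prodRefl (e : BundleIso W W') (V : X → Submodule ℝ F) :
    BundleIso (fun x => (W x).prod (V x)) (fun x => (W' x).prod (V x)) where
  equiv x :=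
    { toFun := fun v => ⟨(e.equiv x ⟨v.1.1, v.2.1⟩, v.1.2), Subtype.coe_prop _, v.2.2⟩
      map_add' := fun u v => Subtype.ext (Prod.ext
        (congrArg Subtype.val (map_add (e.equiv x) ⟨u.1.1, u.2.1⟩ ⟨v.1.1, v.2.1⟩)) rfl)
      map_smul' := fun c v => Subtype.ext (Prod.ext
        (congrArg Subtype.val (map_smul (e.equiv x) c ⟨v.1.1, v.2.1⟩)) rfl)
      invFun := fun v => ⟨((e.equiv x).symm ⟨v.1.1, v.2.1⟩, v.1.2), Subtype.coe_prop _, v.2.2⟩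
      left_inv := fun v => Subtype.ext (Prod.ext
        (congrArg Subtype.val ((e.equiv x).symm_apply_apply ⟨v.1.1, v.2.1⟩)) rfl)
      right_inv := fun v => Subtype.ext (Prod.ext
        (congrArg Subtype.val ((e.equiv x).apply_symm_apply ⟨v.1.1, v.2.1⟩)) rfl) }
  continuous_equiv := by
    have h : Continuous fun p : Total fun x => (W x).prod (V x) =>
        (⟨(p.1.1, p.1.2.1), p.2.1⟩ : Total W) :=
      ((continuous_fst.comp continuous_subtype_val).prodMk
        (continuous_fst.comp (continuous_snd.comp continuous_subtype_val))).subtype_mk _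
    exact (e.continuous_equiv.comp h).prodMk
      (continuous_snd.comp (continuous_snd.comp continuous_subtype_val))
  continuous_symm := by
    have h : Continuous fun p : Total fun x => (W' x).prod (V x) =>
        (⟨(p.1.1, p.1.2.1), p.2.1⟩ : Total W') :=
      ((continuous_fst.comp continuous_subtype_val).prodMk
        (continuous_fst.comp (continuous_snd.comp continuous_subtype_val))).subtype_mk _
    exact (e.continuous_symm.comp h).prodMk
      (continuous_snd.comp (continuous_snd.comp continuous_subtype_val))

end BundleCalculus

/-- The images of a continuous family of idempotents form a vector bundle. -/
theorem isVectorBundle_of_idempotents {X E : Type*} [TopologicalSpace X] [NormedAddCommGroup E]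
    [NormedSpace ℝ E] [FiniteDimensional ℝ E] {W : X → Submodule ℝ E} (Q : X → E →L[ℝ] E)
    (hQ : Continuous Q) (hmem : ∀ x v, Q x v ∈ W x) (hid : ∀ x, ∀ v ∈ W x, Q x v = v) :
    IsVectorBundle W := by
  intro x₀
  have : CompleteSpace E := FiniteDimensional.complete ℝ E
  -- `T x` intertwines the idempotents `Q x₀` and `Q x` and is the identity for `x = x₀`.
  let T : X → E →L[ℝ] E := fun x => Q x * Q x₀ + (1 - Q x) * (1 - Q x₀)
  have hQQ : ∀ x, Q x * Q x = Q x := fun x =>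
    ContinuousLinearMap.ext fun v => hid x _ (hmem x v)
  have hT : Continuous T :=
    (hQ.mul continuous_const).add ((continuous_const.sub hQ).mul continuous_const)
  have hT0 : T x₀ = 1 := by
    simp only [T]
    rw [mul_sub, sub_mul, sub_mul, hQQ]
    simp
  have hTQ : ∀ x, T x * Q x₀ = Q x * T x := by
    intro x
    simp only [T]
    have h1 := hQQ x
    have h2 := hQQ x₀
    have e1 : (1 - Q x₀) * Q x₀ = 0 := by rw [sub_mul, h2, one_mul, sub_self]
    have e2 : Q x * (1 - Q x) = 0 := by rw [mul_sub, h1, mul_one, sub_self]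
    rw [add_mul, mul_add, mul_assoc, mul_assoc, e1, h2, ← mul_assoc, ← mul_assoc, h1, e2]
    simp
  let φ : W x₀ ≃L[ℝ] EuclideanSpace ℝ (Fin (Module.finrank ℝ (W x₀))) :=
    ContinuousLinearEquiv.ofFinrankEq (by simp)
  let p : E →L[ℝ] W x₀ := (Q x₀).codRestrict (W x₀) (hmem x₀)
  let U : Set X := {x | IsUnit (T x)}
  have hinv : Continuous fun y : U => Ring.inverse (T y.1) := by
    rw [continuous_iff_continuousAt]
    intro y
    obtain ⟨u, hu⟩ := y.2
    have h : ContinuousAt Ring.inverse (T y.1) := hu ▸ NormedRing.inverse_continuousAt u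
    exact ContinuousAt.comp (f := fun y : U => T y.1) h
      (hT.comp continuous_subtype_val).continuousAt
  refine ⟨U, Units.isOpen.preimage hT, ?_, _, ⟨BundleIso.symm (BundleIso.ofMaps
    (fun y => (T y.1).toLinearMap ∘ₗ (W x₀).subtype ∘ₗ φ.symm.toLinearMap)
    (fun y v => φ (p (Ring.inverse (T y.1) v))) ?_ ?_ ?_ ?_ ?_ ?_)⟩⟩
  · change IsUnit (T x₀)
    rw [hT0]
    exact isUnit_one
  · exact ((hT.comp continuous_subtype_val).comp continuous_fst).clm_apply
      (continuous_subtype_val.comp (φ.symm.continuous.comp continuous_snd))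
  · exact φ.continuous.comp (p.continuous.comp
      ((hinv.comp continuous_fst).clm_apply continuous_snd))
  · intro y v _
    have h : T y.1 (Q x₀ (φ.symm v)) = Q y.1 (T y.1 (φ.symm v)) :=
      DFunLike.congr_fun (hTQ y.1) (φ.symm v : E)
    rw [hid x₀ _ (φ.symm v).2] at h
    change T y.1 (φ.symm v) ∈ W y.1
    rw [h]
    exact hmem _ _
  · intro y v _
    trivial
  · intro y v _
    have h : Ring.inverse (T y.1) (T y.1 (φ.symm v)) = φ.symm v :=
      DFunLike.congr_fun (Ring.inverse_mul_cancel _ y.2) (φ.symm v : E)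
    change φ (p (Ring.inverse (T y.1) (T y.1 (φ.symm v)))) = v
    rw [h, show p (φ.symm v) = φ.symm v from Subtype.ext (hid x₀ _ (φ.symm v).2),
      φ.apply_symm_apply]
  · intro y v hv
    change T y.1 (φ.symm (φ (p (Ring.inverse (T y.1) v)))) = v
    rw [φ.symm_apply_apply]
    have h1 : T y.1 (Q x₀ (Ring.inverse (T y.1) v)) = Q y.1 (T y.1 (Ring.inverse (T y.1) v)) :=
      DFunLike.congr_fun (hTQ y.1) (Ring.inverse (T y.1) v)
    have h2 : T y.1 (Ring.inverse (T y.1) v) = v :=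
      DFunLike.congr_fun (Ring.mul_inverse_cancel _ y.2) v
    change T y.1 (Q x₀ (Ring.inverse (T y.1) v)) = v
    rw [h1, h2]
    exact hid y.1 v hv

/-! ### The negative eigenbundle -/

section NegativeBundle

/-- An index set for the negative scalar eigenvectors belonging to `L`, `V₀`, `V₊` and `V₋`;
if `A` has `r - 2` elements, the cardinalities are `r - 1`, `r - 1`, `r` and `r - 2`. -/
def NegIndex (m : ℕ) (A : Type) : Option SignType → Type
  | none => Fin m ⊕ Fin m
  | some .zero => Option A
  | some .neg => A
  | some .pos => Option (Option A)

instance (m : ℕ) (A : Type) [Fintype A] : ∀ τ, Fintype (NegIndex m A τ)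
  | none => inferInstanceAs (Fintype (Fin m ⊕ Fin m))
  | some .zero => inferInstanceAs (Fintype (Option A))
  | some .neg => inferInstanceAs (Fintype A)
  | some .pos => inferInstanceAs (Fintype (Option (Option A)))

lemma card_negIndex {r m : ℕ} (hm : r = 2 * m + 1) (hr : 3 ≤ r) (τ : Option SignType) :
    (Fintype.card (NegIndex m (Fin (r - 2)) τ) : ℤ) = r - 1 + ((τ.getD 0 : SignType) : ℤ) := by
  rcases τ with _ | _ | _ | _
  · have h : Fintype.card (NegIndex m (Fin (r - 2)) none) = m + m := by
      change Fintype.card (Fin m ⊕ Fin m) = _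
      simp
    rw [h, hm]
    simp
    ring
  · have h : Fintype.card (NegIndex m (Fin (r - 2)) (some .zero)) = r - 2 + 1 := by
      change Fintype.card (Option (Fin (r - 2))) = _
      simp
    rw [h]
    change _ = (r : ℤ) - 1 + 0
    omega
  · have h : Fintype.card (NegIndex m (Fin (r - 2)) (some .neg)) = r - 2 := by
      change Fintype.card (Fin (r - 2)) = _
      simp
    rw [h]
    change _ = (r : ℤ) - 1 + -1
    omega
  · have h : Fintype.card (NegIndex m (Fin (r - 2)) (some .pos)) = r - 2 + 1 + 1 := by
      change Fintype.card (Option (Option (Fin (r - 2)))) = _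
      simp
    rw [h]
    change _ = (r : ℤ) - 1 + 1
    omega

variable {n₁ n₂ : ℕ}

lemma Base.continuous_starProjection_split_clm (τ : Option SignType) :
    Continuous fun x : Base n₁ n₂ => (x.split τ).starProjection :=
  continuous_clm_apply.2 (Base.continuous_starProjection_split τ)

/-- The direct sum of copies of the bundles `L`, `V₀`, `V₊`, `V₋`, indexed by `K`. -/
def splitSum {K : Option SignType → Type} (x : Base n₁ n₂) :
    Submodule ℝ ((Σ τ, K τ) → EuclideanSpace ℂ (Fin n₁ ⊕ Fin n₂)) :=
  Submodule.pi Set.univ fun k => x.split k.1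

lemma mem_splitSum {K : Option SignType → Type} {x : Base n₁ n₂}
    {f : (Σ τ, K τ) → EuclideanSpace ℂ (Fin n₁ ⊕ Fin n₂)} :
    f ∈ splitSum x ↔ ∀ k, f k ∈ x.split k.1 := by
  simp [splitSum, Submodule.mem_pi]

section Spectral

variable {r : ℕ} [NeZero r] {K : Option SignType → Type} [∀ τ, Fintype (K τ)]
  {N : Option SignType → Type} [∀ τ, Fintype (N τ)]

/-- The spectral decomposition of the Hessian: a configuration in the negative eigenspace is
given by its coefficients, with values in `L`, `V₀`, `V₊` and `V₋`, with respect to the negative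
scalar eigenvectors. -/
def negEigenbundleIso
    (b : ∀ τ, OrthonormalBasis (K τ ⊕ N τ) ℝ (EuclideanSpace ℂ (ZMod r)))
    (μ : ∀ τ, K τ ⊕ N τ → ℝ)
    (hb : ∀ τ k, scalarAction (gridRho r (τ.getD 0)) (b τ k) = μ τ k • b τ k)
    (hneg : ∀ τ k, μ τ (Sum.inl k) < 0) (hpos : ∀ τ k, 0 ≤ μ τ (Sum.inr k)) :
    BundleIso (splitSum (K := K)) (negEigenbundle r n₁ n₂) :=
  BundleIso.ofMaps
    (fun _ => ∑ k : Σ τ, K τ, tens (b k.1 (Sum.inl k.2)) ∘ₗ LinearMap.proj k)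
    (fun x z k => (x.split k.1).starProjection (pairing (b k.1 (Sum.inl k.2)) z))
    (by
      exact (LinearMap.continuous_of_finiteDimensional
        (∑ k : Σ τ, K τ, tens (b k.1 (Sum.inl k.2)) ∘ₗ LinearMap.proj k)).comp continuous_snd)
    (continuous_pi fun k =>
      ((Base.continuous_starProjection_split_clm k.1).comp continuous_fst).clm_apply
        ((pairing _).continuous_of_finiteDimensional.comp continuous_snd))
    (fun x f hf => by
      rw [LinearMap.sum_apply]
      exact Submodule.sum_mem _ fun k _ => tens_mem_negEigenspace
        (fun τ v hv j c => x.conj_loop_smul τ v hv j c) hb hneg k.1 k.2 (mem_splitSum.1 hf k))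
    (fun x z _ => mem_splitSum.2 fun k => Submodule.starProjection_apply_mem _ _)
    (fun x f hf => by
      classical
      ext1 k
      have h : ∀ k' : Σ τ, K τ, (x.split k.1).starProjection (pairing (b k.1 (Sum.inl k.2))
          (tens (b k'.1 (Sum.inl k'.2)) (f k'))) = if k = k' then f k' else 0 := by
        intro k'
        have := x.isRealSplitting.starProjection_pairing_tens b ⟨k.1, Sum.inl k.2⟩
          ⟨k'.1, Sum.inl k'.2⟩ (mem_splitSum.1 hf k')
        refine this.trans ?_
        have hiff : ((⟨k.1, Sum.inl k.2⟩ : Σ τ, K τ ⊕ N τ) = ⟨k'.1, Sum.inl k'.2⟩) ↔ k = k' := by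
          obtain ⟨τ, k⟩ := k
          obtain ⟨τ', k'⟩ := k'
          constructor
          · intro h
            obtain ⟨rfl, h⟩ := Sigma.mk.inj h
            exact congrArg (Sigma.mk τ) (Sum.inl.inj (eq_of_heq h))
          · rintro ⟨⟩
            rfl
        simp only [hiff]
      simp only [LinearMap.sum_apply, LinearMap.comp_apply, LinearMap.proj_apply, map_sum, h]
      simp)
    (fun x z hz => by
      simp only [LinearMap.sum_apply, LinearMap.comp_apply, LinearMap.proj_apply]
      exact x.isRealSplitting.sum_tens_of_mem_negEigenspace
        (fun τ v hv j c => x.conj_loop_smul τ v hv j c) hb hpos hz)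

/-- The spectral projections onto the negative eigenspaces depend continuously on the loop. -/
lemma isVectorBundle_negEigenbundle
    (b : ∀ τ, OrthonormalBasis (K τ ⊕ N τ) ℝ (EuclideanSpace ℂ (ZMod r)))
    (μ : ∀ τ, K τ ⊕ N τ → ℝ)
    (hb : ∀ τ k, scalarAction (gridRho r (τ.getD 0)) (b τ k) = μ τ k • b τ k)
    (hneg : ∀ τ k, μ τ (Sum.inl k) < 0) (hpos : ∀ τ k, 0 ≤ μ τ (Sum.inr k)) :
    IsVectorBundle (negEigenbundle r n₁ n₂) := by
  refine isVectorBundle_of_idempotents (fun x => ∑ k : Σ τ, K τ,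
    (LinearMap.toContinuousLinearMap (tens (b k.1 (Sum.inl k.2)))).comp
      ((x.split k.1).starProjection.comp
        (LinearMap.toContinuousLinearMap (pairing (b k.1 (Sum.inl k.2)))))) ?_ ?_ ?_
  · exact continuous_finsetSum _ fun k _ => continuous_const.clm_comp
      ((Base.continuous_starProjection_split_clm k.1).clm_comp continuous_const)
  · intro x z
    rw [sum_apply]
    exact Submodule.sum_mem _ fun k _ => tens_mem_negEigenspace
      (fun τ v hv j c => x.conj_loop_smul τ v hv j c) hb hneg k.1 k.2
      (Submodule.starProjection_apply_mem _ _)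
  · intro x z hz
    rw [sum_apply]
    exact x.isRealSplitting.sum_tens_of_mem_negEigenspace
      (fun τ v hv j c => x.conj_loop_smul τ v hv j c) hb hpos hz

end Spectral

section Model

variable {m : ℕ} {A : Type}

/-- The inclusion of `ℝ^{n₂}` in `ℂ^{n₁} ⊕ ℂ^{n₂}`. -/
def realInr : EuclideanSpace ℝ (Fin n₂) →ₗ[ℝ] EuclideanSpace ℂ (Fin n₁ ⊕ Fin n₂) :=
  inrC.comp ofRealVec

/-- The real part of the second component of a vector of `ℂ^{n₁} ⊕ ℂ^{n₂}`. -/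
def reSnd : EuclideanSpace ℂ (Fin n₁ ⊕ Fin n₂) →ₗ[ℝ] EuclideanSpace ℝ (Fin n₂) :=
  reVec.comp sndC

lemma reSnd_realInr (v : EuclideanSpace ℝ (Fin n₂)) :
    reSnd (realInr v : EuclideanSpace ℂ (Fin n₁ ⊕ Fin n₂)) = v :=
  reVec_ofRealVec v

lemma Base.mem_split_some {x : Base n₁ n₂} {s : SignType}
    {w : EuclideanSpace ℂ (Fin n₁ ⊕ Fin n₂)} (hw : w ∈ x.split (some s)) :
    reSnd w ∈ x.2.triple.part s ∧ realInr (reSnd w) = w := by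
  obtain ⟨u, hu, rfl⟩ := hw
  have h : reSnd (realInr u : EuclideanSpace ℂ (Fin n₁ ⊕ Fin n₂)) = u := reSnd_realInr u
  exact ⟨(congrArg (· ∈ x.2.triple.part s) h).mpr hu, congrArg realInr h⟩

lemma Base.starProjection_realInr (x : Base n₁ n₂) (s : SignType)
    (v : EuclideanSpace ℝ (Fin n₂)) :
    (x.split (some s)).starProjection (realInr v) = realInr (x.2.triple.proj s v) := by
  rw [Base.starProjection_split_some]
  exact congrArg (fun u => realInr (x.2.triple.proj s u)) (reVec_ofRealVec v)

/-- The fibres of `ℂ^{n₁ m} ⊕ ℝ^{n₂ A} ⊕ V₊ ⊕ V₊ ⊕ V₀`. -/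
def model (m : ℕ) (A : Type) (x : Base n₁ n₂) :
    Submodule ℝ (((Fin m → EuclideanSpace ℂ (Fin n₁)) × (A → EuclideanSpace ℝ (Fin n₂))) ×
      (EuclideanSpace ℝ (Fin n₂) × (EuclideanSpace ℝ (Fin n₂) × EuclideanSpace ℝ (Fin n₂)))) :=
  Submodule.prod ⊤ ((x.2.triple.part 1).prod ((x.2.triple.part 1).prod (x.2.triple.part 0)))

/-- The components of a sum of copies of `L`, `V₀`, `V₊`, `V₋` in the model bundle: two copies of
`L` are combined to `L ⊕ iL = ℂ^{n₁}`, copies of `V₀`, `V₊` and `V₋` to `ℝ^{n₂}`. -/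
def toModel : ((Σ τ, NegIndex m A τ) → EuclideanSpace ℂ (Fin n₁ ⊕ Fin n₂)) →ₗ[ℝ]
    ((Fin m → EuclideanSpace ℂ (Fin n₁)) × (A → EuclideanSpace ℝ (Fin n₂))) ×
      (EuclideanSpace ℝ (Fin n₂) × (EuclideanSpace ℝ (Fin n₂) × EuclideanSpace ℝ (Fin n₂))) where
  toFun f :=
    ((fun k => fstC (f ⟨none, .inl k⟩) + mulI _ (fstC (f ⟨none, .inr k⟩)),
      fun a => reSnd (f ⟨some .pos, some (some a)⟩) + reSnd (f ⟨some .neg, a⟩)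
        + reSnd (f ⟨some .zero, some a⟩)),
      reSnd (f ⟨some .pos, none⟩), reSnd (f ⟨some .pos, some none⟩), reSnd (f ⟨some .zero, none⟩))
  map_add' f f' := by
    simp only [Pi.add_apply, map_add, Prod.mk_add_mk]
    refine Prod.ext (Prod.ext ?_ ?_) rfl
    · ext1 k
      exact add_add_add_comm _ _ _ _
    · ext1 a
      simp only [Pi.add_apply]
      abel
  map_smul' c f := by
    simp only [Pi.smul_apply, map_smul, RingHom.id_apply, Prod.smul_mk]
    refine Prod.ext (Prod.ext ?_ ?_) rfl
    · ext1 k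
      exact (smul_add _ _ _).symm
    · ext1 a
      simp only [Pi.smul_apply, smul_add]

/-- The vectors whose projections are the summands belonging to a point of the model bundle. -/
def ofModel (p : ((Fin m → EuclideanSpace ℂ (Fin n₁)) × (A → EuclideanSpace ℝ (Fin n₂))) ×
      (EuclideanSpace ℝ (Fin n₂) × (EuclideanSpace ℝ (Fin n₂) × EuclideanSpace ℝ (Fin n₂)))) :
    (Σ τ, NegIndex m A τ) → EuclideanSpace ℂ (Fin n₁ ⊕ Fin n₂)
  | ⟨none, .inl k⟩ => inlC (p.1.1 k)
  | ⟨none, .inr k⟩ => inlC (-mulI _ (p.1.1 k))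
  | ⟨some .zero, none⟩ => realInr p.2.2.2
  | ⟨some .zero, some a⟩ => realInr (p.1.2 a)
  | ⟨some .neg, a⟩ => realInr (p.1.2 a)
  | ⟨some .pos, none⟩ => realInr p.2.1
  | ⟨some .pos, some none⟩ => realInr p.2.2.1
  | ⟨some .pos, some (some a)⟩ => realInr (p.1.2 a)

lemma continuous_ofModel_apply (k : Σ τ, NegIndex m A τ) :
    Continuous fun p => ofModel (n₁ := n₁) (n₂ := n₂) p k := by
  have h1 := (inlC (ι := Fin n₁) (κ := Fin n₂)).continuous_of_finiteDimensional
  have h2 := (mulI (EuclideanSpace ℂ (Fin n₁))).continuous_of_finiteDimensional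
  have h3 := (realInr (n₁ := n₁) (n₂ := n₂)).continuous_of_finiteDimensional
  rcases k with ⟨_ | _ | _ | _, k⟩
  · rcases k with k | k
    · exact h1.comp (by fun_prop)
    · exact h1.comp (h2.comp (by fun_prop)).neg
  · rcases k with _ | a
    · exact h3.comp (by fun_prop)
    · exact h3.comp (by fun_prop)
  · exact h3.comp (by fun_prop)
  · rcases k with _ | _ | a
    · exact h3.comp (by fun_prop)
    · exact h3.comp (by fun_prop)
    · exact h3.comp (by fun_prop)

lemma Base.starProjection_inlC (x : Base n₁ n₂) {u u' : EuclideanSpace ℂ (Fin n₁)}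
    (hu : u ∈ x.1.1) (hu' : u' ∈ x.1.1) :
    (x.split none).starProjection (inlC (u + mulI _ u')) = inlC u := by
  rw [Base.starProjection_split_none, fstC_inlC, map_add, Lag.starProjection_mulI,
    Submodule.starProjection_eq_self_iff.2 hu, Submodule.starProjection_eq_self_iff.2 hu', sub_self,
    map_zero, add_zero]

lemma mulI_mulI {ι : Type*} (u : EuclideanSpace ℂ ι) : mulI _ (mulI _ u) = -u := by
  simp [mulI_apply, smul_smul]

lemma starProjection_ofModel_toModel (x : Base n₁ n₂)
    {f : (Σ τ, NegIndex m A τ) → EuclideanSpace ℂ (Fin n₁ ⊕ Fin n₂)} (hf : f ∈ splitSum x)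
    (k : Σ τ, NegIndex m A τ) :
    (x.split k.1).starProjection (ofModel (toModel f) k) = f k := by
  rw [mem_splitSum] at hf
  -- Projections of single summands and of sums of vectors of `V₊`, `V₋` and `V₀`.
  have h1 : ∀ s k, (x.split (some s)).starProjection (realInr (reSnd (f ⟨some s, k⟩))) =
      f ⟨some s, k⟩ := fun s k => by
    obtain ⟨ha, hb⟩ := Base.mem_split_some (hf ⟨some s, k⟩)
    rw [x.starProjection_realInr, Triple.proj_of_mem _ ha, hb]
  have h2 : ∀ s s', s ≠ s' → ∀ k,
      (x.split (some s)).starProjection (realInr (reSnd (f ⟨some s', k⟩))) = 0 := fun s s' h k => by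
    obtain ⟨ha, -⟩ := Base.mem_split_some (hf ⟨some s', k⟩)
    rw [x.starProjection_realInr, Triple.proj_of_mem_of_ne _ h ha, map_zero]
  have hadd : ∀ {s} {u v w : EuclideanSpace ℝ (Fin n₂)}
      {u' v' w' z : EuclideanSpace ℂ (Fin n₁ ⊕ Fin n₂)},
      (x.split (some s)).starProjection (realInr u) = u' →
      (x.split (some s)).starProjection (realInr v) = v' →
      (x.split (some s)).starProjection (realInr w) = w' → u' + v' + w' = z →
      (x.split (some s)).starProjection (realInr (u + v + w)) = z := by
    rintro s u v w _ _ _ _ rfl rfl rfl rfl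
    rw [map_add, map_add, map_add, map_add]
  rcases k with ⟨_ | _ | _ | _, k⟩
  · rcases k with k | k
    all_goals
      obtain ⟨u, hu, hu'⟩ := hf ⟨none, .inl k⟩
      obtain ⟨v, hv, hv'⟩ := hf ⟨none, .inr k⟩
      have hz : (toModel f).1.1 k = u + mulI _ v := by
        change fstC (f ⟨none, .inl k⟩) + mulI _ (fstC (f ⟨none, .inr k⟩)) = _
        rw [← hu', ← hv', fstC_inlC, fstC_inlC]
    · change (x.split none).starProjection (inlC ((toModel f).1.1 k)) = _
      rw [hz, x.starProjection_inlC hu hv, hu']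
    · change (x.split none).starProjection (inlC (-mulI _ ((toModel f).1.1 k))) = _
      have e : -mulI _ (u + mulI _ v) = v + mulI _ (-u) := by
        rw [map_add, mulI_mulI, map_neg]
        abel
      rw [hz, e, x.starProjection_inlC hv (Submodule.neg_mem _ hu), hv']
  · rcases k with _ | a
    · exact h1 .zero none
    · exact hadd (h2 .zero .pos (by decide) (some (some a))) (h2 .zero .neg (by decide) a)
        (h1 .zero (some a)) (by rw [add_zero, zero_add])
  · exact hadd (h2 .neg .pos (by decide) (some (some k))) (h1 .neg k)
      (h2 .neg .zero (by decide) (some k)) (by rw [add_zero, zero_add])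
  · rcases k with _ | _ | a
    · exact h1 .pos none
    · exact h1 .pos (some none)
    · exact hadd (h1 .pos (some (some a))) (h2 .pos .neg (by decide) a)
        (h2 .pos .zero (by decide) (some a)) (by rw [add_zero, add_zero])

lemma toModel_starProjection_ofModel (x : Base n₁ n₂) {p} (hp : p ∈ model m A x) :
    toModel (fun k => (x.split k.1).starProjection (ofModel p k)) = p := by
  have h : ∀ s v, reSnd ((x.split (some s)).starProjection
      (realInr v : EuclideanSpace ℂ (Fin n₁ ⊕ Fin n₂))) = x.2.triple.proj s v := fun s v => by
    rw [x.starProjection_realInr, reSnd_realInr]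
  refine Prod.ext (Prod.ext (funext fun k => ?_) (funext fun a => ?_))
    (Prod.ext ?_ (Prod.ext ?_ ?_))
  · change fstC ((x.split none).starProjection (inlC (p.1.1 k))) + mulI _ (fstC
      ((x.split none).starProjection (inlC (-mulI _ (p.1.1 k))))) = _
    rw [Base.starProjection_split_none, Base.starProjection_split_none, fstC_inlC, fstC_inlC,
      fstC_inlC, fstC_inlC, map_neg, Lag.starProjection_mulI, map_neg, mulI_mulI]
    abel
  · change reSnd ((x.split (some .pos)).starProjection (realInr (p.1.2 a))) +
      reSnd ((x.split (some .neg)).starProjection (realInr (p.1.2 a))) +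
      reSnd ((x.split (some .zero)).starProjection (realInr (p.1.2 a))) = _
    rw [h, h, h]
    exact x.2.triple.proj_add_proj _
  · exact (h .pos _).trans (Triple.proj_of_mem _ hp.2.1)
  · exact (h .pos _).trans (Triple.proj_of_mem _ hp.2.2.1)
  · exact (h .zero _).trans (Triple.proj_of_mem _ hp.2.2.2)

lemma toModel_mem (x : Base n₁ n₂)
    {f : (Σ τ, NegIndex m A τ) → EuclideanSpace ℂ (Fin n₁ ⊕ Fin n₂)} (hf : f ∈ splitSum x) :
    toModel f ∈ model m A x := by
  rw [mem_splitSum] at hf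
  exact ⟨trivial, (Base.mem_split_some (hf ⟨some .pos, none⟩)).1,
    (Base.mem_split_some (hf ⟨some .pos, some none⟩)).1,
    (Base.mem_split_some (hf ⟨some .zero, none⟩)).1⟩

/-- The sum of copies of `L`, `V₀`, `V₊`, `V₋` is isomorphic to the model bundle. -/
def splitSumIso [Fintype A] :
    BundleIso (splitSum (n₁ := n₁) (n₂ := n₂) (K := NegIndex m A)) (model m A) :=
  BundleIso.ofMaps (fun _ => toModel) (fun x p k => (x.split k.1).starProjection (ofModel p k))
    (toModel.continuous_of_finiteDimensional.comp continuous_snd)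
    (continuous_pi fun k =>
      ((Base.continuous_starProjection_split_clm k.1).comp continuous_fst).clm_apply
        ((continuous_ofModel_apply k).comp continuous_snd))
    (fun x _ hf => toModel_mem x hf)
    (fun _ _ _ => mem_splitSum.2 fun _ => Submodule.starProjection_apply_mem _ _)
    (fun x _ hf => funext fun k => starProjection_ofModel_toModel x hf k)
    (fun x _ hp => toModel_starProjection_ofModel x hp)

lemma continuous_proj_base (s : SignType) :
    Continuous fun x : Base n₁ n₂ => x.2.triple.proj s :=
  continuous_clm_apply.2 fun v => (StdLoop.continuous_proj s v).comp continuous_snd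

lemma Triple.mem_minus_orthogonal_iff {ι : Type*} [Fintype ι] (T : Triple ι)
    (v : EuclideanSpace ℝ ι) : v ∈ T.minusᗮ ↔ T.proj (-1) v = 0 :=
  (Submodule.starProjection_apply_eq_zero_iff _).symm

/-- The summands `V₊ ⊕ V₀` of the model bundle combine to the orthogonal complement of `V₋`. -/
def modelIsoOrthogonal [Fintype A] {N : ℕ}
    (φ : ((Fin m → EuclideanSpace ℂ (Fin n₁)) × (A → EuclideanSpace ℝ (Fin n₂))) ≃L[ℝ]
      EuclideanSpace ℝ (Fin N)) :
    BundleIso (model m A) (fun x : Base n₁ n₂ => (trivialBundle (Base n₁ n₂) N x).prod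
      ((Vplus x.2).prod (Vminus x.2)ᗮ)) :=
  BundleIso.ofMaps
    (fun _ => φ.toLinearMap.prodMap (LinearMap.id.prodMap
      (LinearMap.id.coprod LinearMap.id)))
    (fun x p => (φ.symm p.1, p.2.1, x.2.triple.proj 1 p.2.2, x.2.triple.proj 0 p.2.2))
    ((LinearMap.continuous_of_finiteDimensional _).comp continuous_snd)
    ((φ.symm.continuous.comp (continuous_fst.comp continuous_snd)).prodMk
      ((continuous_fst.comp (continuous_snd.comp continuous_snd)).prodMk
        ((((continuous_proj_base 1).comp continuous_fst).clm_apply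
            (continuous_snd.comp (continuous_snd.comp continuous_snd))).prodMk
          (((continuous_proj_base 0).comp continuous_fst).clm_apply
            (continuous_snd.comp (continuous_snd.comp continuous_snd))))))
    (fun x p hp => ⟨trivial, hp.2.1, (x.2.triple.mem_minus_orthogonal_iff _).2 (by
      change x.2.triple.proj (-1) (p.2.2.1 + p.2.2.2) = 0
      rw [map_add, Triple.proj_of_mem_of_ne _ (by decide) hp.2.2.1,
        Triple.proj_of_mem_of_ne _ (by decide) hp.2.2.2, add_zero])⟩)
    (fun x p hp => ⟨trivial, hp.2.1, Triple.proj_mem _ _ _, Triple.proj_mem _ _ _⟩)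
    (fun x p hp => by
      refine Prod.ext (φ.symm_apply_apply _) (Prod.ext rfl (Prod.ext ?_ ?_))
      · change x.2.triple.proj 1 (p.2.2.1 + p.2.2.2) = _
        rw [map_add, Triple.proj_of_mem _ hp.2.2.1,
          Triple.proj_of_mem_of_ne _ (by decide) hp.2.2.2, add_zero]
      · change x.2.triple.proj 0 (p.2.2.1 + p.2.2.2) = _
        rw [map_add, Triple.proj_of_mem _ hp.2.2.2,
          Triple.proj_of_mem_of_ne _ (by decide) hp.2.2.1, zero_add])
    (fun x p hp => by
      refine Prod.ext (φ.apply_symm_apply _) (Prod.ext rfl ?_)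
      change x.2.triple.proj 1 p.2.2 + x.2.triple.proj 0 p.2.2 = _
      have h := x.2.triple.proj_add_proj p.2.2
      rwa [(x.2.triple.mem_minus_orthogonal_iff _).1 hp.2.2, add_zero] at h)

/-- Rearrangement of a vector of `model ⊕ V₋`, with the components in `V₊`, `V₋` and `V₀`
added up. -/
def addParts {T G : Type*} [AddCommGroup T] [Module ℝ T] [AddCommGroup G] [Module ℝ G] :
    (T × (G × (G × G))) × G →ₗ[ℝ] G × (T × G) where
  toFun p := (p.1.2.1, p.1.1, p.1.2.2.1 + p.2 + p.1.2.2.2)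
  map_add' p q := Prod.ext rfl (Prod.ext rfl (by
    change p.1.2.2.1 + q.1.2.2.1 + (p.2 + q.2) + (p.1.2.2.2 + q.1.2.2.2) =
      p.1.2.2.1 + p.2 + p.1.2.2.2 + (q.1.2.2.1 + q.2 + q.1.2.2.2)
    abel))
  map_smul' c p := Prod.ext rfl (Prod.ext rfl (by
    change c • p.1.2.2.1 + c • p.2 + c • p.1.2.2.2 = c • (p.1.2.2.1 + p.2 + p.1.2.2.2)
    rw [smul_add, smul_add]))

/-- After addition of `V₋`, the summands `V₊ ⊕ V₀ ⊕ V₋` combine to the trivial bundle `ℝ^{n₂}`. -/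
def modelProdIso [Fintype A] {N : ℕ}
    (φ : (((Fin m → EuclideanSpace ℂ (Fin n₁)) × (A → EuclideanSpace ℝ (Fin n₂))) ×
      EuclideanSpace ℝ (Fin n₂)) ≃L[ℝ] EuclideanSpace ℝ (Fin N)) :
    BundleIso (fun x : Base n₁ n₂ => (model m A x).prod (Vminus x.2))
      (fun x => (Vplus x.2).prod (trivialBundle (Base n₁ n₂) N x)) :=
  BundleIso.ofMaps
    (fun _ => LinearMap.id.prodMap φ.toLinearMap ∘ₗ addParts)
    (fun x q => (((φ.symm q.2).1, q.1, x.2.triple.proj 1 (φ.symm q.2).2,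
      x.2.triple.proj 0 (φ.symm q.2).2), x.2.triple.proj (-1) (φ.symm q.2).2))
    ((LinearMap.continuous_of_finiteDimensional _).comp continuous_snd)
    (by
      have h : Continuous fun q : Base n₁ n₂ ×
          (EuclideanSpace ℝ (Fin n₂) × EuclideanSpace ℝ (Fin N)) => φ.symm q.2.2 :=
        φ.symm.continuous.comp (continuous_snd.comp continuous_snd)
      have hs := fun s => ((continuous_proj_base (n₁ := n₁) s).comp continuous_fst).clm_apply
        (continuous_snd.comp h)
      exact ((continuous_fst.comp h).prodMk ((continuous_fst.comp continuous_snd).prodMk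
        ((hs 1).prodMk (hs 0)))).prodMk (hs (-1)))
    (fun x p hp => ⟨hp.1.2.1, trivial⟩)
    (fun x q hq => ⟨⟨trivial, hq.1, Triple.proj_mem _ _ _, Triple.proj_mem _ _ _⟩,
      Triple.proj_mem _ (-1) _⟩)
    (fun x p hp => by
      obtain ⟨⟨t, a, b, c⟩, d⟩ := p
      obtain ⟨⟨-, ha, hb, hc⟩, hd⟩ := hp
      have hd' : d ∈ x.2.triple.part (-1) := hd
      change (((φ.symm (φ (t, b + d + c))).1, a,
        x.2.triple.proj 1 (φ.symm (φ (t, b + d + c))).2,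
        x.2.triple.proj 0 (φ.symm (φ (t, b + d + c))).2),
        x.2.triple.proj (-1) (φ.symm (φ (t, b + d + c))).2) = ((t, a, b, c), d)
      simp only [φ.symm_apply_apply, map_add,
        Triple.proj_of_mem _ hb, Triple.proj_of_mem _ hc, Triple.proj_of_mem _ hd',
        Triple.proj_of_mem_of_ne _ (show (1 : SignType) ≠ -1 by decide) hd',
        Triple.proj_of_mem_of_ne _ (show (1 : SignType) ≠ 0 by decide) hc,
        Triple.proj_of_mem_of_ne _ (show (-1 : SignType) ≠ 1 by decide) hb,
        Triple.proj_of_mem_of_ne _ (show (-1 : SignType) ≠ 0 by decide) hc,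
        Triple.proj_of_mem_of_ne _ (show (0 : SignType) ≠ 1 by decide) hb,
        Triple.proj_of_mem_of_ne _ (show (0 : SignType) ≠ -1 by decide) hd', add_zero, zero_add])
    (fun x q hq => Prod.ext rfl (by
      have h : ((φ.symm q.2).1, x.2.triple.proj 1 (φ.symm q.2).2 +
          x.2.triple.proj (-1) (φ.symm q.2).2 + x.2.triple.proj 0 (φ.symm q.2).2) = φ.symm q.2 :=
        Prod.ext rfl (x.2.triple.proj_add_proj _)
      exact (congrArg φ h).trans (φ.apply_symm_apply q.2)))

end Model

end NegativeBundle

end MaslovReduction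

end

theorem mainTheorem8 :
    ∃ r₀ : ℕ, ∀ (r : ℕ) [NeZero r], Odd r → r₀ ≤ r → ∀ n₁ n₂ : ℕ,
      IsVectorBundle (negEigenbundle r n₁ n₂) ∧
      Nonempty (BundleIso (negEigenbundle r n₁ n₂)
        (fun x => (trivialBundle (Base n₁ n₂) ((n₁ + n₂) * (r - 2) + n₁) x).prod
          ((Vplus x.2).prod (Vminus x.2)ᗮ))) ∧
      Nonempty (BundleIso (fun x => (negEigenbundle r n₁ n₂ x).prod (Vminus x.2))
        (fun x => (Vplus x.2).prod
          (trivialBundle (Base n₁ n₂) ((n₁ + n₂) * (r - 1)) x))) := by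
  refine ⟨3, fun r _ hodd hr n₁ n₂ => ?_⟩
  obtain ⟨m, hm⟩ := id hodd
  choose N b μ hb hneg hpos using fun τ : Option SignType =>
    exists_scalar_eigenbasis hodd hr (τ.getD 0) (NegIndex m (Fin (r - 2)) τ) (card_negIndex hm hr τ)
  have e : BundleIso (negEigenbundle r n₁ n₂) (model m (Fin (r - 2))) :=
    (negEigenbundleIso b μ hb hneg hpos).symm.trans splitSumIso
  have hdim : Module.finrank ℝ ((Fin m → EuclideanSpace ℂ (Fin n₁)) ×
      (Fin (r - 2) → EuclideanSpace ℝ (Fin n₂))) = m * (n₁ * 2) + (r - 2) * n₂ := by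
    have h : Module.finrank ℝ (EuclideanSpace ℂ (Fin n₁)) = n₁ * 2 := by
      rw [(WithLp.linearEquiv 2 ℝ (Fin n₁ → ℂ)).finrank_eq, Module.finrank_pi_fintype]
      simp
    simp [Module.finrank_pi_fintype, h]
  obtain ⟨k, rfl⟩ : ∃ k, m = k + 1 := ⟨m - 1, by omega⟩
  have h2 : r - 2 = 2 * k + 1 := by omega
  have h1 : r - 1 = 2 * k + 2 := by omega
  refine ⟨isVectorBundle_negEigenbundle b μ hb hneg hpos, ⟨e.trans (modelIsoOrthogonal
    (ContinuousLinearEquiv.ofFinrankEq ?_))⟩, ⟨(e.prodRefl _).trans (modelProdIso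
    (ContinuousLinearEquiv.ofFinrankEq ?_))⟩⟩
  · rw [hdim, finrank_euclideanSpace_fin, h2]
    ring
  · rw [Module.finrank_prod, hdim, finrank_euclideanSpace_fin, finrank_euclideanSpace_fin, h2, h1]
    ring
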